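/- **Setting.** Let $\mathcal X\subseteq\mathbb R^d$ be the input space, $s$ the number of fidelity levels and $N$ the number of spatial coordinates. For $t=1,\dots,s$ let $\mathbf h_t:\mathcal X\to\mathbb R^{p_t}$ be known basis functions, $r(\cdot,\cdot\mid\boldsymbol\phi_t)$ a correlation function with parameters $\boldsymbol\phi_t$, and $\mathcal X_t\subset\mathcal X$ the finite set of inputs run at level $t$ (not necessarily nested). Put $\mathring{\mathcal X}_t=(\bigcup_{k>t}\mathcal X_k)\setminus\mathcal X_t$ and $\tilde{\mathcal X}_t=\mathcal X_t\cup\mathring{\mathcal X}_t$, so that $\tilde{\mathcal X}_{t}\subset\tilde{\mathcal X}_{t-1}$, and $\tilde n_t=|\tilde{\mathcal X}_t|$. Let $\mathbf x_0\in\mathcal X$ be a new input, not in any $\tilde{\mathcal X}_t$, and assume that for each $t$ the correlation matrix $r(\cdot,\cdot\mid\boldsymbol\phi_t)$ on $\tilde{\mathcal X}_t\cup\{\mathbf x_0\}$ is positive definite. The parallel partial cokriging model is: for each coordinate $j$, $y_{1,j}=\delta_{1,j}$ and $y_{t,j}(\mathbf x)=\gamma_{t-1,j}\,y_{t-1,j}(\mathbf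 x)+\delta_{t,j}(\mathbf x)$ for $t\ge2$, with real constants $\gamma_{t-1,j}$, where, given the parameters, the $\delta_{t,j}$ are independent over $t$ and $j$ and $\delta_{t,j}\sim\mathcal{GP}(\mathbf h_t^\top(\cdot)\boldsymbol\beta_{t,j},\,\sigma^2_{t,j}\,r(\cdot,\cdot\mid\boldsymbol\phi_t))$. At each coordinate the prior is $\prod_{t=1}^s 1/\sigma_{t,j}^2$, flat in all $\boldsymbol\beta_{t,j}$ and $\gamma_{t-1,j}$. Let $\tilde{\mathbf y}_{t,j}=y_{t,j}(\tilde{\mathcal X}_t)$ be the augmented outputs, $\tilde{\mathbf y}^{\mathscr D}_j=(\tilde{\mathbf y}_{t,j})_{t\le s}$ and $\mathbf y_j(\mathbf x_0)=(y_{1,j}(\mathbf x_0),\dots,y_{s,j}(\mathbf x_0))$. Let $\tilde{\mathbf R}_t=r(\tilde{\mathcal X}_t,\tilde{\mathcal X}_t\mid\boldsymbol\phi_t)$, $\mathbf r_t=r(\tilde{\mathcal X}_t,\mathbf x_0\mid\boldsymbol\phi_t)$, $\tilde{\mathbf T}_{1,j}=\mathbf h_1^\top(\tilde{\mathcal X}_1)$,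 $\mathbf T_{1,j}(\mathbf x_0)=\mathbf h_1(\mathbf x_0)$, and for $t\ge2$, $\tilde{\mathbf T}_{t,j}=[\mathbf h_t^\top(\tilde{\mathcal X}_t),\,y_{t-1,j}(\tilde{\mathcal X}_t)]$ and $\mathbf T_{t,j}(\mathbf x_0)=(\mathbf h_t(\mathbf x_0)^\top,\,y_{t-1,j}(\mathbf x_0))^\top$. Let $q_t$ be the number of columns of $\tilde{\mathbf T}_{t,j}$, so $q_1=p_1$ and $q_t=p_t+1$ for $t\ge2$. Put $$\hat{\mathbf b}_{t,j}=(\tilde{\mathbf T}_{t,j}^\top\tilde{\mathbf R}_t^{-1}\tilde{\mathbf T}_{t,j})^{-1}\tilde{\mathbf T}_{t,j}^\top\tilde{\mathbf R}_t^{-1}\tilde{\mathbf y}_{t,j},\qquad S^2_{t,j}=\tilde{\mathbf y}_{t,j}^\top\tilde{\mathbf R}_t^{-1}\{\mathbf I-\tilde{\mathbf T}_{t,j}(\tilde{\mathbf T}_{t,j}^\top\tilde{\mathbf R}_t^{-1}\tilde{\mathbf T}_{t,j})^{-1}\tilde{\mathbf T}_{t,j}^\top\tilde{\mathbf R}_t^{-1}\}\tilde{\mathbf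 y}_{t,j}.$$ **Proposition (Sequential Prediction).** Fix a coordinate $j$. (i) Given the parameters, $(\tilde{\mathbf y}^{\mathscr D}_j,\mathbf y_j(\mathbf x_0))$ has as density $L$ the product over $t$ of the normal densities of $y_{t,j}(\tilde{\mathcal X}_t\cup\{\mathbf x_0\})$ with mean $\mathbf h_t^\top(\cdot)\boldsymbol\beta_{t,j}+\gamma_{t-1,j}\,y_{t-1,j}(\cdot)$ (only $\mathbf h_1^\top(\cdot)\boldsymbol\beta_{1,j}$ for $t=1$) and covariance $\sigma^2_{t,j}\,r(\cdot,\cdot\mid\boldsymbol\phi_t)$ on these inputs. (ii) Let the augmented data be such that, for every $t$, $\tilde{\mathbf T}_{t,j}$ has full column rank and $S^2_{t,j}>0$. Then the predictive distribution $\pi(\mathbf y_j(\mathbf x_0)\mid\tilde{\mathbf y}^{\mathscr D}_j,\boldsymbol\phi)$, whose density is proportional to the integral of $L$ against the prior, is a probability distribution and factorizes as $$\pi(\mathbf y_j(\mathbf x_0)\mid\tilde{\mathbf y}_j^{\mathscr D},\boldsymbol\phi)=\pi(y_{1,j}(\mathbf x_0)\mid\tilde{\mathbf y}_{1,j},\boldsymbol\phi_1)\prod_{t=2}^{s}\pi(y_{t,j}(\mathbf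 x_0)\mid\tilde{\mathbf y}_{t,j},\tilde{\mathbf y}_{t-1,j},y_{t-1,j}(\mathbf x_0),\boldsymbol\phi_t).$$ Here the factor of level $t$ is the conditional predictive distribution of $y_{t,j}(\mathbf x_0)$ given $\tilde{\mathbf y}^{\mathscr D}_j$ and $y_{k,j}(\mathbf x_0)$, $k<t$. It depends only on the quantities displayed and is the Student-$t$ distribution with degrees of freedom, location and (squared) scale parameter $$\nu_{t}=\tilde n_t-q_t,\qquad \mu_{t,j}=\mathbf T_{t,j}(\mathbf x_0)^\top\hat{\mathbf b}_{t,j}+\mathbf r_t^\top\tilde{\mathbf R}_t^{-1}(\tilde{\mathbf y}_{t,j}-\tilde{\mathbf T}_{t,j}\hat{\mathbf b}_{t,j}),\qquad V_{t,j}=\frac{S^2_{t,j}}{\tilde n_t-q_t}\,c_{t,j},$$ $$c_{t,j}=r(\mathbf x_0,\mathbf x_0\mid\boldsymbol\phi_t)-\mathbf r_t^\top\tilde{\mathbf R}_t^{-1}\mathbf r_t+[\mathbf T_{t,j}(\mathbf x_0)-\tilde{\mathbf T}_{t,j}^\top\tilde{\mathbf R}_t^{-1}\mathbf r_t]^\top(\tilde{\mathbf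 T}_{t,j}^\top\tilde{\mathbf R}_t^{-1}\tilde{\mathbf T}_{t,j})^{-1}[\mathbf T_{t,j}(\mathbf x_0)-\tilde{\mathbf T}_{t,j}^\top\tilde{\mathbf R}_t^{-1}\mathbf r_t],$$ where $\nu_t>0$ and $V_{t,j}>0$. -/

import Mathlib

open MeasureTheory ProbabilityTheory Matrix
open scoped ENNReal

noncomputable section

namespace PPCokriging

/-! ### Two families of densities -/

/-- Density of the multivariate normal distribution `N(m, C)` on `ℝ^ι`. -/
def normalPDF {ι : Type*} [Fintype ι] [DecidableEq ι]
    (m : ι → ℝ) (C : Matrix ι ι ℝ) (y : ι → ℝ) : ℝ :=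
  (Real.sqrt ((2 * Real.pi) ^ Fintype.card ι * C.det))⁻¹ *
    Real.exp (-((y - m) ⬝ᵥ (C⁻¹ *ᵥ (y - m))) / 2)

/-- Density of the Student-t distribution with `ν` degrees of freedom, location `m` and
(squared) scale parameter `V`. -/
def studentPDF (ν m V x : ℝ) : ℝ :=
  Real.Gamma ((ν + 1) / 2) / (Real.Gamma (ν / 2) * Real.sqrt (ν * Real.pi * V)) *
    (1 + (x - m) ^ 2 / (ν * V)) ^ (-((ν + 1) / 2))

/-- The Student-t distribution with `ν` degrees of freedom, location `m` and (squared) scale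
parameter `V`, as a measure on `ℝ`. -/
def studentT (ν m V : ℝ) : Measure ℝ :=
  volume.withDensity fun x => ENNReal.ofReal (studentPDF ν m V x)

/-! ### Fidelity levels, inputs and designs -/

/-- The level immediately below `t`: this type is empty for the first level and has exactly one
element for every other level. -/
abbrev Pred {s : ℕ} (t : Fin s) : Type := {u : Fin s // u.val + 1 = t.val}

/-- The known ingredients of the model, on the input space `𝒳 ⊆ ℝ^d` with `s` levels. Nothing is
assumed about them here. -/
structure Setup (d s : ℕ) (𝒳 : Set (EuclideanSpace ℝ (Fin d))) where
  /-- number of basis functions at each level -/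
  p : Fin s → ℕ
  /-- basis functions of the mean at each level, common to all spatial coordinates -/
  h : (t : Fin s) → 𝒳 → Fin (p t) → ℝ
  /-- the correlation function `r(x, x' | φ)`, with the parameter as first argument -/
  r : (Fin d → ℝ) → 𝒳 → 𝒳 → ℝ
  /-- the correlation parameters at each level, common to all spatial coordinates -/
  φ : Fin s → Fin d → ℝ
  /-- the inputs at which the simulator of each level was run (not necessarily nested) -/
  X : Fin s → Finset 𝒳
  /-- the new input -/
  x0 : 𝒳

variable {d s : ℕ} {𝒳 : Set (EuclideanSpace ℝ (Fin d))}

open Classical in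
/-- The missing inputs at level `t`: the inputs run at some higher level but not at level `t`. -/
def Setup.missing (S : Setup d s 𝒳) (t : Fin s) : Finset 𝒳 :=
  (Finset.univ.filter fun k : Fin s => t < k).biUnion S.X \ S.X t

open Classical in
/-- The augmented design at level `t`. -/
def Setup.aug (S : Setup d s 𝒳) (t : Fin s) : Finset 𝒳 := S.X t ∪ S.missing t

/-- The augmented designs are nested. -/
theorem Setup.aug_subset (S : Setup d s 𝒳) {u t : Fin s} (hut : u.val + 1 = t.val)
    {x : 𝒳} (hx : x ∈ S.aug t) : x ∈ S.aug u := by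
  classical
  have hlt : u < t := by rw [Fin.lt_def]; omega
  simp only [Setup.aug, Setup.missing, Finset.mem_union, Finset.mem_sdiff, Finset.mem_biUnion,
    Finset.mem_filter, Finset.mem_univ, true_and] at hx ⊢
  by_cases hu : x ∈ S.X u
  · exact Or.inl hu
  · refine Or.inr ⟨?_, hu⟩
    rcases hx with hx | ⟨⟨k, hk, hxk⟩, -⟩
    · exact ⟨t, hlt, hx⟩
    · exact ⟨k, hlt.trans hk, hxk⟩

/-- Indices of the regression coefficients at level `t`: one for each basis function and, above
the first level, one for the scale discrepancy. -/
abbrev Setup.Reg (S : Setup d s 𝒳) (t : Fin s) : Type := Fin (S.p t) ⊕ Pred t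

/-- Augmented output at one spatial coordinate, over all levels and all augmented designs. -/
abbrev Setup.Data (S : Setup d s 𝒳) : Type := (t : Fin s) → S.aug t → ℝ

/-- Parameters at one spatial coordinate: the vectors `b_t = (β_t, γ_{t-1})` (only `β_1` at the
first level) and the variances `σ²_t`. -/
abbrev Setup.Params (S : Setup d s 𝒳) : Type := ((t : Fin s) → S.Reg t → ℝ) × (Fin s → ℝ)

/-! ### The model -/

/-- `Z` is, under `P`, a Gaussian process with mean function `m` and covariance function `c`. -/
structure IsGP {Ω T : Type*} [MeasurableSpace Ω] (Z : T → Ω → ℝ) (P : Measure Ω)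
    (m : T → ℝ) (c : T → T → ℝ) : Prop where
  isGaussianProcess : IsGaussianProcess Z P
  mean : ∀ x, ∫ ω, Z x ω ∂P = m x
  cov : ∀ x x', covariance (Z x) (Z x') P = c x x'

/-- The discrepancy `δ_t(x) = y_t(x) - γ_{t-1} y_{t-1}(x)` of a family `y` of output functions at
one coordinate; at the first level it is `y_1(x)` itself. -/
def Setup.discrepancy (S : Setup d s 𝒳) {Ω : Type*} (y : Fin s → 𝒳 → Ω → ℝ)
    (θ : S.Params) (t : Fin s) (x : 𝒳) (ω : Ω) : ℝ :=
  y t x ω - ∑ u : Pred t, θ.1 t (Sum.inr u) * y u.1 x ω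

/-- The parallel partial cokriging model with `N` spatial coordinates: under the distribution
`P θ` belonging to the parameters `θ` with positive variances, the outputs satisfy
`y_{t,j}(x) = γ_{t-1,j} y_{t-1,j}(x) + δ_{t,j}(x)`, where the processes `δ_{1,j} = y_{1,j}` and
`δ_{t,j}` are independent over all levels `t` and coordinates `j`, and `δ_{t,j}` is a Gaussian
process with mean `h_tᵀ β_{t,j}` and covariance function `σ²_{t,j} r(·,· | φ_t)`. -/
structure Setup.IsModel (S : Setup d s 𝒳) {N : ℕ} {Ω : Type*} [MeasurableSpace Ω]
    (y : Fin N → Fin s → 𝒳 → Ω → ℝ) (P : (Fin N → S.Params) → Measure Ω) : Prop where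
  measurable : ∀ j t x, Measurable (y j t x)
  isProbabilityMeasure : ∀ θ : Fin N → S.Params, (∀ j t, 0 < (θ j).2 t) →
    IsProbabilityMeasure (P θ)
  isGP : ∀ θ : Fin N → S.Params, (∀ j t, 0 < (θ j).2 t) → ∀ j t,
    IsGP (S.discrepancy (y j) (θ j) t) (P θ)
      (fun x => ∑ i, S.h t x i * (θ j).1 t (Sum.inl i))
      (fun x x' => (θ j).2 t * S.r (S.φ t) x x')
  indep : ∀ θ : Fin N → S.Params, (∀ j t, 0 < (θ j).2 t) →
    iIndepFun (fun (a : Fin N × Fin s) (ω : Ω) (x : 𝒳) =>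
      S.discrepancy (y a.1) (θ a.1) a.2 x ω) (P θ)

/-- The augmented output and the outputs at the new input, over all levels, of a family `y` of
output functions at one coordinate. -/
def Setup.observe (S : Setup d s 𝒳) {Ω : Type*} (y : Fin s → 𝒳 → Ω → ℝ) (ω : Ω) :
    S.Data × (Fin s → ℝ) :=
  (fun t x => y t x.1 ω, fun t => y t S.x0 ω)

/-- The noninformative prior at one coordinate: flat in all `β_t` and `γ_{t-1}` and
proportional to `1 / σ²_t` in each variance. (The constant does not affect predictive
distributions.) -/
def Setup.prior (S : Setup d s 𝒳) : Measure S.Params :=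
  (volume : Measure ((t : Fin s) → S.Reg t → ℝ)).prod
    (Measure.pi fun _ : Fin s =>
      (volume.restrict (Set.Ioi (0 : ℝ))).withDensity fun v => ENNReal.ofReal (1 / v))

/-! ### Design matrices and correlation matrices -/

/-- The matrix `T̃_t = [H̃_t, W̃_{t-1}]` over the augmented design of level `t`; it is `H̃_1` at
the first level. The column `W̃_{t-1}` holds the level `t-1` outputs at the inputs of level `t`. -/
def Setup.T (S : Setup d s 𝒳) (t : Fin s) (Y : S.Data) : Matrix (S.aug t) (S.Reg t) ℝ :=
  Matrix.of fun x =>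
    Sum.elim (fun i => S.h t x.1 i) (fun u => Y u.1 ⟨x.1, S.aug_subset u.2 x.2⟩)

/-- The row `T_t(x_0) = [h_t(x_0), y_{t-1}(x_0)]`; it is `h_1(x_0)` at the first level. Here `y0`
is the vector of outputs at the new input over all levels. -/
def Setup.T0 (S : Setup d s 𝒳) (t : Fin s) (y0 : Fin s → ℝ) : S.Reg t → ℝ :=
  Sum.elim (fun i => S.h t S.x0 i) (fun u => y0 u.1)

/-- The correlation matrix of level `t` on its augmented design. -/
def Setup.R (S : Setup d s 𝒳) (t : Fin s) : Matrix (S.aug t) (S.aug t) ℝ :=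
  Matrix.of fun x x' => S.r (S.φ t) x.1 x'.1

/-- The correlations of level `t` between its augmented design and the new input. -/
def Setup.r0 (S : Setup d s 𝒳) (t : Fin s) : S.aug t → ℝ :=
  fun x => S.r (S.φ t) x.1 S.x0

/-- The inputs of the augmented design of level `t` together with the new input (`none`). -/
def Setup.pt (S : Setup d s 𝒳) (t : Fin s) : Option (S.aug t) → 𝒳
  | none => S.x0
  | some x => x.1

/-- The correlation matrix of level `t` on its augmented design enlarged by the new input. -/
def Setup.Rfull (S : Setup d s 𝒳) (t : Fin s) :
    Matrix (Option (S.aug t)) (Option (S.aug t)) ℝ :=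
  Matrix.of fun a a' => S.r (S.φ t) (S.pt t a) (S.pt t a')

/-- The design matrix of level `t` on its augmented design enlarged by the new input. -/
def Setup.Tfull (S : Setup d s 𝒳) (t : Fin s) (Y : S.Data) (y0 : Fin s → ℝ) :
    Matrix (Option (S.aug t)) (S.Reg t) ℝ :=
  Matrix.of fun a => a.elim (S.T0 t y0) (fun x => S.T t Y x)

/-- The level `t` outputs on its augmented design enlarged by the new input. -/
def Setup.yfull (S : Setup d s 𝒳) (t : Fin s) (Y : S.Data) (y0 : Fin s → ℝ) :
    Option (S.aug t) → ℝ :=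
  fun a => a.elim (y0 t) (Y t)

/-! ### Sampling density and predictive distributions -/

open Classical in
/-- The sampling density of the augmented output `Y` and the outputs `y0` at the new input, at
one coordinate, given the parameters: the product over the levels of the densities of
`N(T_t b_t, σ²_t R_t)` on the augmented design enlarged by the new input. -/
def Setup.sampling (S : Setup d s 𝒳) (θ : S.Params) (Y : S.Data) (y0 : Fin s → ℝ) : ℝ≥0∞ :=
  ∏ t, ENNReal.ofReal
    (normalPDF (S.Tfull t Y y0 *ᵥ θ.1 t) (θ.2 t • S.Rfull t) (S.yfull t Y y0))

/-- The sampling density integrated against the prior: the marginal density of the augmented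
output and the outputs at the new input given the correlation parameters. -/
def Setup.marginal (S : Setup d s 𝒳) (Y : S.Data) (y0 : Fin s → ℝ) : ℝ≥0∞ :=
  ∫⁻ θ, S.sampling θ Y y0 ∂S.prior

/-- The predictive density at `y0` of the outputs at the new input over all levels, given the
augmented output. -/
def Setup.predictiveDensity (S : Setup d s 𝒳) (Y : S.Data) (y0 : Fin s → ℝ) : ℝ≥0∞ :=
  S.marginal Y y0 / ∫⁻ z, S.marginal Y z

/-- The predictive distribution of the outputs at the new input over all levels, given the
augmented output. -/
def Setup.predictive (S : Setup d s 𝒳) (Y : S.Data) : Measure (Fin s → ℝ) :=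
  volume.withDensity (S.predictiveDensity Y)

/-- The conditional predictive density at `u` of the level `t` output at the new input, given the
augmented output and the outputs `y0 k`, `k < t`, at the new input of the lower levels: in the
predictive density the levels above `t` are integrated out, and the result is normalized in the
level `t` variable. The entries `y0 k` with `k ≥ t` play no role. -/
def Setup.condDensity (S : Setup d s 𝒳) (t : Fin s) (Y : S.Data) (y0 : Fin s → ℝ) (u : ℝ) :
    ℝ≥0∞ :=
  lmarginal (fun _ => volume) (Finset.Ioi t) (S.predictiveDensity Y) (Function.update y0 t u) /
    lmarginal (fun _ => volume) (Finset.Ici t) (S.predictiveDensity Y) y0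

/-- The conditional predictive distribution of the level `t` output at the new input, given the
augmented output and the lower-level outputs at the new input. -/
def Setup.condPredictive (S : Setup d s 𝒳) (t : Fin s) (Y : S.Data) (y0 : Fin s → ℝ) :
    Measure ℝ :=
  volume.withDensity (S.condDensity t Y y0)

/-! ### Degrees of freedom, location and scale -/

/-- Generalized least squares coefficients `(TᵀR⁻¹T)⁻¹TᵀR⁻¹y`. -/
def glsCoef {ι κ : Type*} [Fintype ι] [DecidableEq ι] [Fintype κ] [DecidableEq κ]
    (T : Matrix ι κ ℝ) (R : Matrix ι ι ℝ) (y : ι → ℝ) : κ → ℝ :=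
  ((Tᵀ * R⁻¹ * T)⁻¹ * Tᵀ * R⁻¹) *ᵥ y

/-- The quadratic form `yᵀQy` with `Q = R⁻¹{I - T(TᵀR⁻¹T)⁻¹TᵀR⁻¹}`. -/
def glsS2 {ι κ : Type*} [Fintype ι] [DecidableEq ι] [Fintype κ] [DecidableEq κ]
    (T : Matrix ι κ ℝ) (R : Matrix ι ι ℝ) (y : ι → ℝ) : ℝ :=
  y ⬝ᵥ ((R⁻¹ * (1 - T * (Tᵀ * R⁻¹ * T)⁻¹ * Tᵀ * R⁻¹)) *ᵥ y)

/-- The degrees of freedom `ñ_t - q_t`: the number of inputs in the augmented design minus the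
number of columns of `T̃_t`. -/
def Setup.dof (S : Setup d s 𝒳) (t : Fin s) : ℝ :=
  ((S.aug t).card : ℝ) - (Fintype.card (S.Reg t) : ℝ)

open Classical in
/-- The quadratic form `S²(φ_t, Y_t)`. -/
def Setup.S2 (S : Setup d s 𝒳) (t : Fin s) (Y : S.Data) : ℝ :=
  glsS2 (S.T t Y) (S.R t) (Y t)

open Classical in
/-- The location `T_t(x_0) b̂_t + r_tᵀ(x_0) R̃_t⁻¹ (Y_t - T̃_t b̂_t)`. -/
def Setup.location (S : Setup d s 𝒳) (t : Fin s) (Y : S.Data) (y0 : Fin s → ℝ) : ℝ :=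
  S.T0 t y0 ⬝ᵥ glsCoef (S.T t Y) (S.R t) (Y t) +
    S.r0 t ⬝ᵥ ((S.R t)⁻¹ *ᵥ (Y t - S.T t Y *ᵥ glsCoef (S.T t Y) (S.R t) (Y t)))

open Classical in
/-- The factor `c_t(x_0)` of the scale. -/
def Setup.c (S : Setup d s 𝒳) (t : Fin s) (Y : S.Data) (y0 : Fin s → ℝ) : ℝ :=
  S.r (S.φ t) S.x0 S.x0 - S.r0 t ⬝ᵥ ((S.R t)⁻¹ *ᵥ S.r0 t) +
    (S.T0 t y0 - ((S.T t Y)ᵀ * (S.R t)⁻¹) *ᵥ S.r0 t) ⬝ᵥ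
      (((S.T t Y)ᵀ * (S.R t)⁻¹ * S.T t Y)⁻¹ *ᵥ
        (S.T0 t y0 - ((S.T t Y)ᵀ * (S.R t)⁻¹) *ᵥ S.r0 t))

/-- The (squared) scale parameter `S²(φ_t, Y_t) / (ñ_t - q_t) * c_t(x_0)`. -/
def Setup.scale (S : Setup d s 𝒳) (t : Fin s) (Y : S.Data) (y0 : Fin s → ℝ) : ℝ :=
  S.S2 t Y / S.dof t * S.c t Y y0

/-- Regular augmented output: at every level the matrix `T̃_t` has full column rank and
`S²(φ_t, Y_t) > 0`, that is, `Y_t` is not an exact combination of the columns of `T̃_t`. -/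
def Setup.Regular (S : Setup d s 𝒳) (Y : S.Data) : Prop :=
  ∀ t, LinearIndependent ℝ (fun c : S.Reg t => fun x => S.T t Y x c) ∧ 0 < S.S2 t Y

end PPCokriging

end

/-!
Write `b_t = (β_t, γ_{t-1})`. Every level is a generalized least squares problem: integrating the
normal density against the flat prior in `b_t` and `1 / σ²_t` in the variance leaves the evidence

  `(det R · det (Tᵀ R⁻¹ T))^(-1/2) (S²)^(-(n - q) / 2)`,

up to a constant depending only on `n - q`. The prior is a product, so the marginal density is the
product of these evidences, one per level, and the factor of level `t` involves the new outputs of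
levels `t - 1` and `t` only.

To see the dependence on the new output `u` of a level, note that `det R · det (Tᵀ R⁻¹ T)` is up to
sign the determinant of the saddle point matrix `[[R, T], [Tᵀ, 0]]`. Adding the input `x₀` borders
this matrix by one row and one column; the Schur complement of the new corner is `c`. Hence the
determinant gains the factor `c`, while `S²` becomes `S² + (u - μ)² / c`, and the ratio of the
evidences with and without `x₀` is the Student density. Its integral over `u` is one, so the levels
can be integrated out from the top.

For the sampling density, the discrepancies are `(1 - lag) y` with `lag` nilpotent, so passing from
discrepancies to outputs has Jacobian determinant one.
-/

noncomputable section

namespace PPCokriging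

section ProductMeasures

variable {ι : Type*} [Fintype ι] {α : ι → Type*} [∀ i, MeasurableSpace (α i)]
  {μ : ∀ i, Measure (α i)} [∀ i, SigmaFinite (μ i)]

/- Integrating the variables of `U` from the largest to the smallest, each factor is met when it is
the only one left that involves its own variable. -/
theorem lmarginal_prod_of_isUpperSet [LinearOrder ι] {f : ι → (∀ i, α i) → ℝ≥0∞} {c : ι → ℝ≥0∞}
    (hf : ∀ i, Measurable (f i)) (hdep : ∀ i, DependsOn (f i) (Set.Iic i))
    (hint : ∀ i x, ∫⁻ z, f i (Function.update x i z) ∂μ i = c i)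
    {U : Finset ι} (hU : IsUpperSet (U : Set ι)) (x : ∀ i, α i) :
    lmarginal μ U (fun x => ∏ i, f i x) x = (∏ i ∈ U, c i) * ∏ i ∈ Uᶜ, f i x := by
  induction U using Finset.induction_on_min generalizing x with
  | empty => simp
  | insert a V haV ih =>
    have ha : a ∉ V := fun h => lt_irrefl a (haV a h)
    have hV : IsUpperSet (V : Set ι) := fun i k hik hi =>
      (Finset.mem_insert.1 (hU hik (Finset.mem_insert_of_mem hi))).resolve_left
        ((haV i hi).trans_le hik).ne'
    have hlow (z : α a) : ∏ i ∈ (insert a V)ᶜ, f i (Function.update x a z) =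
        ∏ i ∈ (insert a V)ᶜ, f i x := by
      refine Finset.prod_congr rfl fun i hi => hdep i fun k hki => Function.update_of_ne ?_ _ _
      rintro rfl
      exact Finset.mem_compl.1 hi (hU hki (Finset.mem_insert_self k V))
    have hcompl (x : ∀ i, α i) : ∏ i ∈ Vᶜ, f i x = f a x * ∏ i ∈ (insert a V)ᶜ, f i x := by
      rw [Finset.compl_insert, Finset.mul_prod_erase _ (f · x) (Finset.mem_compl.2 ha)]
    have hfa : Measurable fun z => f a (Function.update x a z) := (hf a).comp (measurable_update x)
    rw [lmarginal_insert _ (Finset.measurable_prod _ fun i _ => hf i) ha]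
    simp_rw [ih hV, hcompl, hlow]
    rw [lintegral_const_mul _ (hfa.mul_const _), lintegral_mul_const _ hfa, hint,
      Finset.prod_insert ha]
    ring

theorem lintegral_pi_prod {f : ∀ i, α i → ℝ≥0∞} (hf : ∀ i, Measurable (f i)) :
    ∫⁻ x, ∏ i, f i (x i) ∂Measure.pi μ = ∏ i, ∫⁻ z, f i z ∂μ i := by
  by_cases hα : ∀ i, Nonempty (α i)
  · let _ : LinearOrder ι := LinearOrder.lift' (Fintype.equivFin ι) (Equiv.injective _)
    obtain ⟨x⟩ : Nonempty (∀ i, α i) := inferInstance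
    rw [lintegral_eq_lmarginal_univ x, lmarginal_prod_of_isUpperSet
      (f := fun i x => f i (x i)) (c := fun i => ∫⁻ z, f i z ∂μ i)]
    · simp
    · fun_prop
    · exact fun i x y h => congrArg (f i) (h i Set.self_mem_Iic)
    · simp
    · simp [isUpperSet_univ]
  · obtain ⟨i, hi⟩ : ∃ i, IsEmpty (α i) := by simpa using hα
    have : IsEmpty (∀ i, α i) := isEmpty_pi.2 ⟨i, hi⟩
    rw [Measure.eq_zero_of_isEmpty (Measure.pi μ), lintegral_zero_measure,
      Finset.prod_eq_zero (Finset.mem_univ i)]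
    rw [Measure.eq_zero_of_isEmpty (μ i), lintegral_zero_measure]

theorem lintegral_pi_prod_pi_prod {β : ι → Type*} [∀ i, MeasurableSpace (β i)]
    {ν : ∀ i, Measure (β i)} [∀ i, SigmaFinite (ν i)] {f : ∀ i, α i × β i → ℝ≥0∞}
    (hf : ∀ i, Measurable (f i)) :
    ∫⁻ p, ∏ i, f i (p.1 i, p.2 i) ∂(Measure.pi μ).prod (Measure.pi ν) =
      ∏ i, ∫⁻ b, (∫⁻ a, f i (a, b) ∂μ i) ∂ν i := by
  rw [lintegral_prod_symm' _ (by fun_prop)]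
  simp_rw [fun b : ∀ i, β i => lintegral_pi_prod (μ := μ) (f := fun i a => f i (a, b i))
    (by fun_prop)]
  exact lintegral_pi_prod fun i => (hf i).lintegral_prod_left'

theorem measurePreserving_pi_prod_pi {β : ι → Type*} [∀ i, MeasurableSpace (β i)]
    {ν : ∀ i, Measure (β i)} [∀ i, SigmaFinite (ν i)] :
    MeasurePreserving (fun (p : (∀ i, α i) × ∀ i, β i) i => (p.1 i, p.2 i))
      ((Measure.pi μ).prod (Measure.pi ν)) (Measure.pi fun i => (μ i).prod (ν i)) where
  measurable := by fun_prop
  map_eq := by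
    refine (Measure.pi_eq fun s hs => ?_).symm
    set pair := fun (p : (∀ i, α i) × ∀ i, β i) i => (p.1 i, p.2 i)
    have hpair : Measurable pair := by fun_prop
    have hindicator (p) : (pair ⁻¹' Set.univ.pi s).indicator 1 p =
        ∏ i, (s i).indicator (1 : α i × β i → ℝ≥0∞) (p.1 i, p.2 i) := by
      classical
      simp only [Set.indicator_apply, Pi.one_apply, Finset.prod_ite_zero, Finset.prod_const_one,
        Set.mem_preimage, Set.mem_univ_pi, Finset.mem_univ, true_imp_iff, pair]
    rw [Measure.map_apply hpair (MeasurableSet.univ_pi hs),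
      ← lintegral_indicator_one (hpair (MeasurableSet.univ_pi hs))]
    simp_rw [hindicator]
    rw [lintegral_pi_prod_pi_prod fun i => measurable_one.indicator (hs i)]
    refine Finset.prod_congr rfl fun i _ => ?_
    rw [← lintegral_prod_symm' _ (measurable_one.indicator (hs i)), lintegral_indicator_one (hs i)]

theorem pi_withDensity {f : ∀ i, α i → ℝ≥0∞} (hf : ∀ i, Measurable (f i))
    [∀ i, SigmaFinite ((μ i).withDensity (f i))] :
    Measure.pi (fun i => (μ i).withDensity (f i)) =
      (Measure.pi μ).withDensity fun x => ∏ i, f i (x i) := by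
  refine Measure.pi_eq fun s hs => ?_
  rw [withDensity_apply _ (MeasurableSet.univ_pi hs), Measure.restrict_pi_pi,
    lintegral_pi_prod hf]
  exact Finset.prod_congr rfl fun i _ => (withDensity_apply _ (hs i)).symm

end ProductMeasures

theorem map_withDensity_comp {α β : Type*} [MeasurableSpace α] [MeasurableSpace β]
    {μ : Measure α} {g : α → β} (hg : Measurable g) {f : β → ℝ≥0∞} (hf : Measurable f) :
    (μ.withDensity (f ∘ g)).map g = (μ.map g).withDensity f := by
  ext s hs
  rw [Measure.map_apply hg hs, withDensity_apply _ (hg hs), withDensity_apply _ hs,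
    setLIntegral_map hs hf hg]
  rfl

theorem map_eq_withDensity_of_map_comp_eq {Ω α β : Type*} [MeasurableSpace Ω] [MeasurableSpace α]
    [MeasurableSpace β] {P : Measure Ω} {μ : Measure α} {ν : Measure β} {e : α ≃ᵐ β}
    (he : MeasurePreserving e μ ν) {X : Ω → α} (hX : Measurable X) {f : β → ℝ≥0∞}
    (hf : Measurable f) (h : P.map (e ∘ X) = ν.withDensity f) :
    P.map X = μ.withDensity (f ∘ e) := by
  apply e.map_measurableEquiv_injective
  rw [Measure.map_map e.measurable hX, h, map_withDensity_comp e.measurable hf, he.map_eq]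

theorem det_one_sub_of_isNilpotent {K E : Type*} [Field K] [AddCommGroup E] [Module K E]
    [FiniteDimensional K E] {f : Module.End K E} (hf : IsNilpotent f) :
    LinearMap.det (1 - f) = 1 := by
  simpa [hf.charpoly_eq_X_pow_finrank] using (f.eval_charpoly 1).symm

theorem measurePreserving_one_sub_of_isNilpotent {E : Type*} [NormedAddCommGroup E]
    [NormedSpace ℝ E] [FiniteDimensional ℝ E] [MeasurableSpace E] [BorelSpace E] (μ : Measure E)
    [μ.IsAddHaarMeasure] {f : Module.End ℝ E} (hf : IsNilpotent f) :
    MeasurePreserving (1 - f : Module.End ℝ E) μ μ where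
  measurable := (LinearMap.continuous_of_finiteDimensional _).measurable
  map_eq := by
    have hdet := det_one_sub_of_isNilpotent hf
    rw [Measure.map_linearMap_addHaar_eq_smul_addHaar μ (hdet ▸ one_ne_zero), hdet]
    simp

section Normal

theorem measurable_mulVec {m n : Type*} [Countable m] [Fintype n] (A : Matrix m n ℝ) :
    Measurable (A *ᵥ ·) :=
  (Continuous.matrix_mulVec continuous_const continuous_id).measurable

variable {ι : Type*} [Fintype ι]

section Moments

variable {Ω : Type*} [MeasurableSpace Ω] {P : Measure Ω} {X : Ω → ι → ℝ}

theorem integral_mulVec (hX : ∀ i, Integrable (fun ω => X ω i) P) {m : ι → ℝ}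
    (hm : ∀ i, ∫ ω, X ω i ∂P = m i) (A : Matrix ι ι ℝ) (i : ι) :
    ∫ ω, (A *ᵥ X ω) i ∂P = (A *ᵥ m) i := by
  simp only [Matrix.mulVec, dotProduct]
  rw [integral_finsetSum _ fun k _ => (hX k).const_mul _]
  simp only [integral_const_mul, hm]

theorem covariance_mulVec [IsFiniteMeasure P] (hX : ∀ i, MemLp (fun ω => X ω i) 2 P)
    {C : Matrix ι ι ℝ} (hC : ∀ i k, covariance (fun ω => X ω i) (fun ω => X ω k) P = C i k)
    (A : Matrix ι ι ℝ) (i k : ι) :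
    covariance (fun ω => (A *ᵥ X ω) i) (fun ω => (A *ᵥ X ω) k) P = (A * C * Aᵀ) i k := by
  simp only [Matrix.mulVec, dotProduct]
  rw [covariance_fun_sum_fun_sum (fun l => (hX l).const_mul _) fun l => (hX l).const_mul _]
  simp only [covariance_const_mul_left, covariance_const_mul_right, hC, Matrix.mul_apply,
    Matrix.transpose_apply, Finset.sum_mul]
  rw [Finset.sum_comm]
  exact Finset.sum_congr rfl fun l _ => Finset.sum_congr rfl fun n _ => by ring

theorem map_eq_pi_gaussianReal [DecidableEq ι] (hX : HasGaussianLaw X P) {m : ι → ℝ}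
    (hm : ∀ i, ∫ ω, X ω i ∂P = m i)
    (hcov : ∀ i k, covariance (fun ω => X ω i) (fun ω => X ω k) P = (1 : Matrix ι ι ℝ) i k) :
    P.map X = Measure.pi fun i => gaussianReal (m i) 1 := by
  have := hX.isProbabilityMeasure
  have hind : iIndepFun (fun i ω => X ω i) P :=
    hX.iIndepFun_of_covariance_eq_zero fun i k hik => by rw [hcov, Matrix.one_apply_ne hik]
  rw [← funext fun i => (?_ : P.map (fun ω => X ω i) = gaussianReal (m i) 1)]
  · exact (iIndepFun_iff_map_fun_eq_pi_map fun i => (hX.eval i).aemeasurable).1 hind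
  · rw [(hX.eval i).map_eq_gaussianReal, hm, ← covariance_self (hX.eval i).aemeasurable, hcov,
      Matrix.one_apply_eq, Real.toNNReal_one]

end Moments

variable [DecidableEq ι]

@[fun_prop]
theorem measurable_normalPDF (m : ι → ℝ) (C : Matrix ι ι ℝ) : Measurable (normalPDF m C) := by
  have hquad : Measurable fun y : ι → ℝ => (y - m) ⬝ᵥ (C⁻¹ *ᵥ (y - m)) :=
    (Continuous.dotProduct (by fun_prop)
      (Continuous.matrix_mulVec continuous_const (by fun_prop))).measurable
  unfold normalPDF
  fun_prop

theorem dotProduct_inv_mul_transpose_mulVec (A : Matrix ι ι ℝ) (z : ι → ℝ) :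
    z ⬝ᵥ ((A * Aᵀ)⁻¹ *ᵥ z) = ∑ i, (A⁻¹ *ᵥ z) i ^ 2 := by
  rw [Matrix.mul_inv_rev, ← Matrix.mulVec_mulVec, Matrix.dotProduct_mulVec,
    ← Matrix.transpose_nonsing_inv, Matrix.vecMul_transpose]
  simp only [dotProduct, sq]

theorem normalPDF_mul_transpose (A : Matrix ι ι ℝ) (m y : ι → ℝ) :
    normalPDF m (A * Aᵀ) y =
      |A.det|⁻¹ * ∏ i, gaussianPDFReal ((A⁻¹ *ᵥ m) i) 1 ((A⁻¹ *ᵥ y) i) := by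
  have hsqrt : √((2 * Real.pi) ^ Fintype.card ι * (A * Aᵀ).det) =
      |A.det| * √(2 * Real.pi) ^ Fintype.card ι := by
    rw [← Real.sqrt_sq (by positivity : 0 ≤ |A.det| * √(2 * Real.pi) ^ Fintype.card ι),
      mul_pow |A.det|, sq_abs, pow_right_comm, Real.sq_sqrt Real.two_pi_pos.le, Matrix.det_mul,
      Matrix.det_transpose, sq, mul_comm]
  have hexp : -((y - m) ⬝ᵥ ((A * Aᵀ)⁻¹ *ᵥ (y - m))) / 2 =
      ∑ i, -((A⁻¹ *ᵥ y) i - (A⁻¹ *ᵥ m) i) ^ 2 / 2 := by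
    rw [dotProduct_inv_mul_transpose_mulVec, Matrix.mulVec_sub, ← Finset.sum_div,
      ← Finset.sum_neg_distrib]
    rfl
  simp only [normalPDF, hsqrt, hexp, gaussianPDFReal, Finset.prod_mul_distrib, Finset.prod_const,
    ← Real.exp_sum, Finset.card_univ, NNReal.coe_one, mul_one, mul_inv, inv_pow, mul_assoc]

theorem map_mulVec_pi_gaussianReal {A : Matrix ι ι ℝ} (hA : A.det ≠ 0) (m : ι → ℝ) :
    (Measure.pi fun i => gaussianReal ((A⁻¹ *ᵥ m) i) 1).map (A *ᵥ ·) =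
      volume.withDensity fun y => ENNReal.ofReal (normalPDF m (A * Aᵀ) y) := by
  have hgauss (i : ι) : gaussianReal ((A⁻¹ *ᵥ m) i) 1 =
      volume.withDensity (gaussianPDF ((A⁻¹ *ᵥ m) i) 1) :=
    gaussianReal_of_var_ne_zero _ one_ne_zero
  have (i : ι) : SigmaFinite (volume.withDensity (gaussianPDF ((A⁻¹ *ᵥ m) i) 1)) :=
    hgauss i ▸ inferInstance
  have hvol : (volume : Measure (ι → ℝ)).map (A *ᵥ ·) =
      ENNReal.ofReal |A.det⁻¹| • volume := Real.map_matrix_volume_pi_eq_smul_volume_pi hA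
  have hdens : (fun z => ∏ i, gaussianPDF ((A⁻¹ *ᵥ m) i) 1 (z i)) =
      (fun y => ∏ i, gaussianPDF ((A⁻¹ *ᵥ m) i) 1 ((A⁻¹ *ᵥ y) i)) ∘ (A *ᵥ ·) := by
    ext z
    simp [Matrix.mulVec_mulVec, Matrix.nonsing_inv_mul _ (isUnit_iff_ne_zero.2 hA)]
  have hmeas : Measurable fun y => ∏ i, gaussianPDF ((A⁻¹ *ᵥ m) i) 1 ((A⁻¹ *ᵥ y) i) :=
    Finset.measurable_prod _ fun i _ => (measurable_gaussianPDF _ _).comp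
      ((measurable_pi_apply i).comp (measurable_mulVec _))
  simp_rw [hgauss]
  rw [pi_withDensity fun i => measurable_gaussianPDF _ _, ← volume_pi, hdens,
    map_withDensity_comp (measurable_mulVec A) hmeas, hvol, withDensity_smul_measure,
    ← withDensity_smul' _ _ ENNReal.ofReal_ne_top]
  congr 1 with y
  simp only [Pi.smul_apply, smul_eq_mul, gaussianPDF, normalPDF_mul_transpose, abs_inv]
  rw [← ENNReal.ofReal_prod_of_nonneg fun i _ => gaussianPDFReal_nonneg _ _ _,
    ← ENNReal.ofReal_mul (by positivity)]

theorem exists_eq_mul_transpose_of_posDef {C : Matrix ι ι ℝ} (hC : C.PosDef) :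
    ∃ A : Matrix ι ι ℝ, A.det ≠ 0 ∧ C = A * Aᵀ := by
  open scoped MatrixOrder in
  obtain ⟨B, hB⟩ := CStarAlgebra.nonneg_iff_eq_star_mul_self.mp hC.posSemidef.nonneg
  have hCB : C = Bᵀ * Bᵀᵀ := by
    rw [hB, Matrix.star_eq_conjTranspose, Matrix.conjTranspose_eq_transpose_of_trivial,
      Matrix.transpose_transpose]
  refine ⟨Bᵀ, fun h => hC.det_pos.ne' ?_, hCB⟩
  rw [hCB, Matrix.det_mul, h, zero_mul]

theorem isProbabilityMeasure_normalPDF (m : ι → ℝ) {C : Matrix ι ι ℝ} (hC : C.PosDef) :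
    IsProbabilityMeasure (volume.withDensity fun y => ENNReal.ofReal (normalPDF m C y)) := by
  obtain ⟨A, hA, rfl⟩ := exists_eq_mul_transpose_of_posDef hC
  rw [← map_mulVec_pi_gaussianReal hA]
  exact Measure.isProbabilityMeasure_map (measurable_mulVec A).aemeasurable

theorem lintegral_normalPDF (m : ι → ℝ) {C : Matrix ι ι ℝ} (hC : C.PosDef) :
    ∫⁻ y, ENNReal.ofReal (normalPDF m C y) = 1 := by
  have := (isProbabilityMeasure_normalPDF m hC).measure_univ
  rwa [withDensity_apply _ MeasurableSet.univ, Measure.restrict_univ] at this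

theorem map_eq_withDensity_normalPDF {Ω : Type*} [MeasurableSpace Ω] {P : Measure Ω}
    {X : Ω → ι → ℝ} (hX : HasGaussianLaw X P) {m : ι → ℝ} {C : Matrix ι ι ℝ}
    (hm : ∀ i, ∫ ω, X ω i ∂P = m i)
    (hcov : ∀ i k, covariance (fun ω => X ω i) (fun ω => X ω k) P = C i k) (hC : C.PosDef) :
    P.map X = volume.withDensity fun y => ENNReal.ofReal (normalPDF m C y) := by
  obtain ⟨A, hA, rfl⟩ := exists_eq_mul_transpose_of_posDef hC
  have := hX.isProbabilityMeasure
  have hAu : IsUnit A.det := isUnit_iff_ne_zero.2 hA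
  have hwhite : A⁻¹ * (A * Aᵀ) * A⁻¹ᵀ = 1 := by
    rw [Matrix.nonsing_inv_mul_cancel_left _ _ hAu, ← Matrix.transpose_mul,
      Matrix.nonsing_inv_mul _ hAu, Matrix.transpose_one]
  have hlaw : P.map (fun ω => A⁻¹ *ᵥ X ω) =
      Measure.pi fun i => gaussianReal ((A⁻¹ *ᵥ m) i) 1 := by
    refine map_eq_pi_gaussianReal ?_ (integral_mulVec (fun i => (hX.eval i).integrable) hm _)
      fun i k => by rw [covariance_mulVec (fun i => (hX.eval i).memLp_two) hcov, hwhite]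
    exact hX.map_fun (LinearMap.toContinuousLinearMap (toLin' A⁻¹))
  rw [← map_mulVec_pi_gaussianReal hA, ← hlaw, AEMeasurable.map_map_of_aemeasurable
    (f := fun ω => A⁻¹ *ᵥ X ω) (measurable_mulVec A).aemeasurable
    ((measurable_mulVec A⁻¹).comp_aemeasurable hX.aemeasurable)]
  simp [Function.comp_def, Matrix.mulVec_mulVec, Matrix.mul_nonsing_inv _ hAu]

end Normal

section Student

theorem lintegral_Ioi_comp_inv (f : ℝ → ℝ≥0∞) :
    ∫⁻ v in Set.Ioi (0 : ℝ), ENNReal.ofReal (v ^ 2)⁻¹ * f v⁻¹ = ∫⁻ v in Set.Ioi (0 : ℝ), f v := by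
  have himage : Inv.inv '' Set.Ioi (0 : ℝ) = Set.Ioi 0 := by
    ext v
    simp
  have hchange := lintegral_image_eq_lintegral_abs_deriv_mul measurableSet_Ioi
    (fun v (hv : 0 < v) => (hasDerivAt_inv hv.ne').hasDerivWithinAt) inv_injective.injOn f
  simpa only [himage, abs_neg, abs_inv, abs_pow, sq_abs] using hchange.symm

theorem setLIntegral_Ioi_gammaPDF {a r : ℝ} (ha : 0 < a) (hr : 0 < r) :
    ∫⁻ v in Set.Ioi (0 : ℝ), gammaPDF a r v = 1 := by
  rw [← lintegral_gammaPDF_eq_one ha hr,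
    ← lintegral_add_compl (μ := volume) (gammaPDF a r) measurableSet_Ioi, Set.compl_Ioi,
    setLIntegral_congr Iio_ae_eq_Iic.symm, lintegral_gammaPDF_of_nonpos le_rfl, add_zero]

theorem lintegral_inverseGamma {a r : ℝ} (ha : 0 < a) (hr : 0 < r) :
    ∫⁻ v in Set.Ioi (0 : ℝ), ENNReal.ofReal (v ^ (-a - 1) * Real.exp (-(r / v))) =
      ENNReal.ofReal (Real.Gamma a * r ^ (-a)) := by
  rw [← lintegral_Ioi_comp_inv, ← mul_one (ENNReal.ofReal (Real.Gamma a * r ^ (-a))),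
    ← setLIntegral_Ioi_gammaPDF ha hr, ← lintegral_const_mul' _ _ ENNReal.ofReal_ne_top]
  refine setLIntegral_congr_fun measurableSet_Ioi fun v (hv : 0 < v) => ?_
  rw [gammaPDF_of_nonneg hv.le, ← ENNReal.ofReal_mul (by positivity),
    ← ENNReal.ofReal_mul (by positivity)]
  congr 1
  have hpow : v⁻¹ ^ (-a - 1) = v ^ 2 * v ^ (a - 1) := by
    rw [Real.inv_rpow hv.le, ← Real.rpow_neg hv.le, ← Real.rpow_natCast, ← Real.rpow_add hv]
    congr 1
    push_cast
    ring
  have hcancel : r ^ (-a) * r ^ a = 1 := by rw [← Real.rpow_add hr, neg_add_cancel, Real.rpow_zero]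
  rw [hpow, div_inv_eq_mul]
  field_simp
  linear_combination -hcancel

@[fun_prop]
theorem measurable_studentPDF {α : Type*} [MeasurableSpace α] (ν : ℝ) {m V x : α → ℝ}
    (hm : Measurable m) (hV : Measurable V) (hx : Measurable x) :
    Measurable fun a => studentPDF ν (m a) (V a) (x a) := by
  unfold studentPDF
  fun_prop

theorem studentPDF_pos {ν m V : ℝ} (hν : 0 < ν) (hV : 0 < V) (x : ℝ) :
    0 < studentPDF ν m V x := by
  have := Real.Gamma_pos_of_pos (show 0 < (ν + 1) / 2 by positivity)
  have := Real.Gamma_pos_of_pos (show 0 < ν / 2 by positivity)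
  have := Real.pi_pos
  unfold studentPDF
  positivity

theorem inverseGamma_mul_gaussianPDFReal {ν V v : ℝ} (hν : 0 < ν) (hV : 0 < V) (hv : 0 < v)
    (m x : ℝ) :
    v ^ (-(ν / 2) - 1) * Real.exp (-(ν / 2 / v)) * gaussianPDFReal m (v * V).toNNReal x =
      (√(2 * Real.pi * V))⁻¹ * (v ^ (-((ν + 1) / 2) - 1) *
        Real.exp (-(ν / 2 * (1 + (x - m) ^ 2 / (ν * V)) / v))) := by
  have hsqrt : √(2 * Real.pi * (v * V)) = √(2 * Real.pi * V) * v ^ (1 / 2 : ℝ) := by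
    rw [← Real.sqrt_eq_rpow, ← Real.sqrt_mul (by positivity)]
    congr 1
    ring
  have hpow : v ^ (-((ν + 1) / 2) - 1) = v ^ (-(ν / 2) - 1) * (v ^ (1 / 2 : ℝ))⁻¹ := by
    rw [← Real.rpow_neg hv.le, ← Real.rpow_add hv]
    congr 1
    ring
  have hexp : Real.exp (-(ν / 2 * (1 + (x - m) ^ 2 / (ν * V)) / v)) =
      Real.exp (-(ν / 2 / v)) * Real.exp (-(x - m) ^ 2 / (2 * (v * V))) := by
    rw [← Real.exp_add]
    congr 1
    field_simp
    ring
  rw [gaussianPDFReal, Real.coe_toNNReal _ (by positivity), hsqrt, hpow, hexp, mul_inv]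
  ring

/- The Student-t distribution is the inverse gamma mixture over `v` of the normal distributions
with variance `v * V`. -/
theorem lintegral_inverseGamma_mul_gaussianPDF {ν V : ℝ} (hν : 0 < ν) (hV : 0 < V) (m x : ℝ) :
    ∫⁻ v in Set.Ioi (0 : ℝ), ENNReal.ofReal (v ^ (-(ν / 2) - 1) * Real.exp (-(ν / 2 / v))) *
        gaussianPDF m (v * V).toNNReal x =
      ENNReal.ofReal (Real.Gamma (ν / 2) * (ν / 2) ^ (-(ν / 2))) *
        ENNReal.ofReal (studentPDF ν m V x) := by
  have hsqrt : √(ν * Real.pi * V) = √(2 * Real.pi * V) * (ν / 2) ^ (1 / 2 : ℝ) := by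
    rw [← Real.sqrt_eq_rpow, ← Real.sqrt_mul (by positivity)]
    congr 1
    ring
  have hpow : (ν / 2) ^ (-((ν + 1) / 2)) = (ν / 2) ^ (-(ν / 2)) * ((ν / 2) ^ (1 / 2 : ℝ))⁻¹ := by
    rw [← Real.rpow_neg (by positivity), ← Real.rpow_add (by positivity)]
    congr 1
    ring
  have hpointwise (v : ℝ) (hv : v ∈ Set.Ioi 0) :
      ENNReal.ofReal (v ^ (-(ν / 2) - 1) * Real.exp (-(ν / 2 / v))) *
          gaussianPDF m (v * V).toNNReal x =
        ENNReal.ofReal (√(2 * Real.pi * V))⁻¹ * ENNReal.ofReal (v ^ (-((ν + 1) / 2) - 1) *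
          Real.exp (-(ν / 2 * (1 + (x - m) ^ 2 / (ν * V)) / v))) := by
    have hv : 0 < v := hv
    rw [gaussianPDF, ← ENNReal.ofReal_mul (by positivity),
      inverseGamma_mul_gaussianPDFReal hν hV hv, ENNReal.ofReal_mul (by positivity)]
  rw [setLIntegral_congr_fun measurableSet_Ioi hpointwise,
    lintegral_const_mul' _ _ ENNReal.ofReal_ne_top,
    lintegral_inverseGamma (by positivity) (by positivity), ← ENNReal.ofReal_mul (by positivity),
    ← ENNReal.ofReal_mul (by positivity), Real.mul_rpow (by positivity) (by positivity), hpow,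
    studentPDF, hsqrt]
  congr 1
  field_simp

theorem lintegral_studentPDF {ν V : ℝ} (hν : 0 < ν) (hV : 0 < V) (m : ℝ) :
    ∫⁻ x, ENNReal.ofReal (studentPDF ν m V x) = 1 := by
  have hmass : 0 < Real.Gamma (ν / 2) * (ν / 2) ^ (-(ν / 2)) := by
    have := Real.Gamma_pos_of_pos (show 0 < ν / 2 by positivity)
    positivity
  have hmeas : Measurable fun p : ℝ × ℝ =>
      ENNReal.ofReal (p.2 ^ (-(ν / 2) - 1) * Real.exp (-(ν / 2 / p.2))) *
        gaussianPDF m (p.2 * V).toNNReal p.1 := by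
    unfold gaussianPDF gaussianPDFReal
    fun_prop
  rw [← ENNReal.mul_eq_left (ENNReal.ofReal_pos.2 hmass).ne' ENNReal.ofReal_ne_top,
    ← lintegral_const_mul' _ _ ENNReal.ofReal_ne_top]
  simp_rw [← lintegral_inverseGamma_mul_gaussianPDF hν hV m]
  rw [lintegral_lintegral_swap hmeas.aemeasurable,
    ← lintegral_inverseGamma (by positivity) (by positivity)]
  refine setLIntegral_congr_fun measurableSet_Ioi fun v (hv : 0 < v) => ?_
  have hvar : (v * V).toNNReal ≠ 0 := (Real.toNNReal_pos.2 (by positivity)).ne'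
  rw [lintegral_const_mul' _ _ ENNReal.ofReal_ne_top, lintegral_gaussianPDF_eq_one m hvar, mul_one]

end Student

section Bordering

variable {n : Type*} [Fintype n] {M : Matrix (Option n) (Option n) ℝ}

theorem mulVec_option_elim (hM : M.IsSymm) (a : ℝ) (x : n → ℝ) :
    M *ᵥ (fun o => o.elim a x) =
      fun o => o.elim (M none none * a + (fun i => M (some i) none) ⬝ᵥ x)
        ((M.submatrix some some *ᵥ x) + a • fun i => M (some i) none) := by
  have hrow (k : n) : M none (some k) = M (some k) none := hM.apply _ _
  ext (_ | i)
  · simp [hrow, Matrix.mulVec, dotProduct, Fintype.sum_option]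
  · simp [Matrix.mulVec, dotProduct, Fintype.sum_option, add_comm, mul_comm]

variable [DecidableEq n]

/-- Schur complement, in a matrix with a distinguished index `none`, of the block of the other
indices. The border is read off the column `none`, as is right for symmetric matrices. -/
def schur (M : Matrix (Option n) (Option n) ℝ) : ℝ :=
  M none none - (fun i => M (some i) none) ⬝ᵥ
    ((M.submatrix some some)⁻¹ *ᵥ fun i => M (some i) none)

theorem det_eq_det_mul_schur (hM : M.IsSymm) (hu : IsUnit (M.submatrix some some).det) :
    M.det = (M.submatrix some some).det * schur M := by
  have := Matrix.invertibleOfIsUnitDet _ hu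
  let e := (Equiv.optionEquivSumPUnit.{0} n).symm
  have hblocks : M.submatrix e e = Matrix.fromBlocks (M.submatrix some some)
      (.of fun i _ => M (some i) none) (.of fun _ i => M (some i) none)
      (.of fun _ _ => M none none) := by
    ext (i | i) (k | _)
    · simp [e]
    · simp [e]
    · simpa [e] using hM.apply _ _
    · simp [e]
  rw [← Matrix.det_submatrix_equiv_self e, hblocks, Matrix.det_fromBlocks₁₁,
    Matrix.invOf_eq_nonsing_inv, Matrix.det_unique (n := PUnit), Matrix.mul_assoc]
  rfl

theorem inv_mulVec_eq_option_elim (hM : M.IsSymm) (hu : IsUnit (M.submatrix some some).det)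
    (hc : schur M ≠ 0) (w : Option n → ℝ) {a : ℝ}
    (ha : a * schur M =
      w none - (fun i => M (some i) none) ⬝ᵥ ((M.submatrix some some)⁻¹ *ᵥ (w ∘ some))) :
    M⁻¹ *ᵥ w = fun o => o.elim a
      ((M.submatrix some some)⁻¹ *ᵥ (w ∘ some - a • fun i => M (some i) none)) := by
  have hMu : IsUnit M.det := by
    rw [det_eq_det_mul_schur hM hu]
    exact hu.mul (isUnit_iff_ne_zero.2 hc)
  refine (Matrix.mulVec_injective_iff_isUnit.2 ((Matrix.isUnit_iff_isUnit_det _).2 hMu)) ?_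
  rw [Matrix.mulVec_mulVec, Matrix.mul_nonsing_inv _ hMu, Matrix.one_mulVec, mulVec_option_elim hM,
    Matrix.mulVec_mulVec, Matrix.mul_nonsing_inv _ hu, Matrix.one_mulVec]
  ext (_ | i)
  · simp only [schur] at ha
    simp only [Option.elim_none, Matrix.mulVec_sub, Matrix.mulVec_smul, dotProduct_sub,
      dotProduct_smul, smul_eq_mul]
    linear_combination -ha
  · simp

theorem dotProduct_inv_mulVec_eq_add_sq_div_schur (hM : M.IsSymm)
    (hu : IsUnit (M.submatrix some some).det) (hc : schur M ≠ 0) (w : Option n → ℝ) :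
    w ⬝ᵥ (M⁻¹ *ᵥ w) = (w ∘ some) ⬝ᵥ ((M.submatrix some some)⁻¹ *ᵥ (w ∘ some)) +
      (w none - (fun i => M (some i) none) ⬝ᵥ ((M.submatrix some some)⁻¹ *ᵥ (w ∘ some))) ^ 2 /
        schur M := by
  set m : n → ℝ := fun i => M (some i) none
  have hswap : (w ∘ some) ⬝ᵥ ((M.submatrix some some)⁻¹ *ᵥ m) =
      m ⬝ᵥ ((M.submatrix some some)⁻¹ *ᵥ (w ∘ some)) := by
    rw [Matrix.dotProduct_mulVec, ← Matrix.mulVec_transpose, Matrix.transpose_nonsing_inv,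
      (hM.submatrix some).eq, dotProduct_comm]
  have hsplit (a : ℝ) (x : n → ℝ) :
      w ⬝ᵥ (fun o => o.elim a x) = w none * a + (w ∘ some) ⬝ᵥ x := by
    simp [dotProduct, Fintype.sum_option]
  rw [inv_mulVec_eq_option_elim hM hu hc w (div_mul_cancel₀ _ hc), hsplit, Matrix.mulVec_sub,
    Matrix.mulVec_smul, dotProduct_sub, dotProduct_smul, hswap, smul_eq_mul]
  ring

end Bordering

section LeastSquares

theorem isSymm_of_posDef {ι : Type*} {C : Matrix ι ι ℝ} (hC : C.PosDef) : C.IsSymm := by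
  rw [Matrix.IsSymm, ← Matrix.conjTranspose_eq_transpose_of_trivial, hC.isHermitian.eq]

variable {ι κ : Type*} [Fintype ι] [DecidableEq ι]

theorem posDef_transpose_mul_inv_mul [Finite κ] {R : Matrix ι ι ℝ} {T : Matrix ι κ ℝ}
    (hR : R.PosDef) (hT : LinearIndependent ℝ T.col) : (Tᵀ * R⁻¹ * T).PosDef := by
  cases nonempty_fintype κ
  simpa only [Matrix.conjTranspose_eq_transpose_of_trivial] using
    hR.inv.conjTranspose_mul_mul_same (Matrix.mulVec_injective_iff.2 hT)

variable [Fintype κ] [DecidableEq κ] {R : Matrix ι ι ℝ} {T : Matrix ι κ ℝ}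

theorem glsS2_eq_dotProduct (y : ι → ℝ) :
    glsS2 T R y = y ⬝ᵥ (R⁻¹ *ᵥ (y - T *ᵥ glsCoef T R y)) := by
  simp only [glsS2, glsCoef, Matrix.mulVec_sub, Matrix.mul_sub, Matrix.sub_mulVec,
    Matrix.mulVec_mulVec, Matrix.mul_one, Matrix.mul_assoc]

theorem mulVec_glsCoef (hG : IsUnit (Tᵀ * R⁻¹ * T).det) (y : ι → ℝ) :
    (Tᵀ * R⁻¹ * T) *ᵥ glsCoef T R y = (Tᵀ * R⁻¹) *ᵥ y := by
  rw [glsCoef, Matrix.mulVec_mulVec, ← Matrix.mul_assoc, ← Matrix.mul_assoc,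
    Matrix.mul_nonsing_inv _ hG, Matrix.one_mul]

theorem dotProduct_residual (hR : R.PosDef) (hT : LinearIndependent ℝ T.col) (y : ι → ℝ)
    (b : κ → ℝ) :
    (y - T *ᵥ b) ⬝ᵥ (R⁻¹ *ᵥ (y - T *ᵥ b)) =
      glsS2 T R y + (b - glsCoef T R y) ⬝ᵥ ((Tᵀ * R⁻¹ * T) *ᵥ (b - glsCoef T R y)) := by
  have hG := (posDef_transpose_mul_inv_mul hR hT).det_pos.ne'.isUnit
  set e := y - T *ᵥ glsCoef T R y with he
  set g := b - glsCoef T R y with hg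
  have horth (d : κ → ℝ) : (T *ᵥ d) ⬝ᵥ (R⁻¹ *ᵥ e) = 0 := by
    rw [dotProduct_comm, Matrix.dotProduct_mulVec, ← Matrix.mulVec_transpose, Matrix.mulVec_mulVec,
      Matrix.mulVec_sub, Matrix.mulVec_mulVec, mulVec_glsCoef hG, sub_self, zero_dotProduct]
  have horth' (d : κ → ℝ) : e ⬝ᵥ (R⁻¹ *ᵥ (T *ᵥ d)) = 0 := by
    rw [Matrix.dotProduct_mulVec, ← Matrix.mulVec_transpose, isSymm_of_posDef hR.inv,
      dotProduct_comm, horth]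
  have hgram : (T *ᵥ g) ⬝ᵥ (R⁻¹ *ᵥ (T *ᵥ g)) = g ⬝ᵥ ((Tᵀ * R⁻¹ * T) *ᵥ g) := by
    rw [← Matrix.mulVec_mulVec, ← Matrix.mulVec_mulVec, Matrix.dotProduct_mulVec g,
      Matrix.vecMul_transpose]
  have hS : glsS2 T R y = e ⬝ᵥ (R⁻¹ *ᵥ e) := by
    rw [glsS2_eq_dotProduct, ← he, he, sub_dotProduct, ← he, horth, sub_zero]
  have hresid : y - T *ᵥ b = e - T *ᵥ g := by
    rw [hg, he, Matrix.mulVec_sub, sub_sub_sub_cancel_right]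
  rw [hresid, Matrix.mulVec_sub R⁻¹, sub_dotProduct, dotProduct_sub, dotProduct_sub, horth, horth',
    hgram, hS]
  ring

theorem card_lt_card_of_glsS2_pos (hR : R.PosDef) (hT : LinearIndependent ℝ T.col) {y : ι → ℝ}
    (hS : 0 < glsS2 T R y) : Fintype.card κ < Fintype.card ι := by
  have hle : Fintype.card κ ≤ Fintype.card ι := by simpa using hT.fintype_card_le_finrank
  refine hle.lt_of_ne fun hcard => ?_
  obtain ⟨b, rfl⟩ : y ∈ LinearMap.range T.mulVecLin := by
    rw [Matrix.range_mulVecLin, hT.span_eq_top_of_card_eq_finrank' (by simpa using hcard)]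
    exact Submodule.mem_top
  have hnonneg := (posDef_transpose_mul_inv_mul hR hT).posSemidef.dotProduct_mulVec_nonneg
    (b - glsCoef T R (T *ᵥ b))
  have hzero := dotProduct_residual hR hT (T *ᵥ b) b
  rw [sub_self, zero_dotProduct] at hzero
  rw [Matrix.mulVecLin_apply] at hS
  rw [star_trivial] at hnonneg
  linarith

theorem det_fromBlocks_transpose_zero (hR : IsUnit R.det) :
    (Matrix.fromBlocks R T Tᵀ 0).det =
      (-1) ^ Fintype.card κ * (R.det * (Tᵀ * R⁻¹ * T).det) := by
  have := Matrix.invertibleOfIsUnitDet _ hR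
  rw [Matrix.det_fromBlocks₁₁, zero_sub, Matrix.det_neg, Matrix.invOf_eq_nonsing_inv]
  ring

theorem inv_fromBlocks_transpose_zero_mulVec (hR : IsUnit R.det)
    (hG : IsUnit (Tᵀ * R⁻¹ * T).det) {y : ι → ℝ} {b z : κ → ℝ}
    (hb : (Tᵀ * R⁻¹ * T) *ᵥ b = (Tᵀ * R⁻¹) *ᵥ y - z) :
    (Matrix.fromBlocks R T Tᵀ 0)⁻¹ *ᵥ Sum.elim y z = Sum.elim (R⁻¹ *ᵥ (y - T *ᵥ b)) b := by
  have hu : IsUnit (Matrix.fromBlocks R T Tᵀ 0).det := by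
    rw [det_fromBlocks_transpose_zero hR]
    exact (isUnit_one.neg.pow _).mul (hR.mul hG)
  have hsolve : Matrix.fromBlocks R T Tᵀ 0 *ᵥ Sum.elim (R⁻¹ *ᵥ (y - T *ᵥ b)) b =
      Sum.elim y z := by
    rw [Matrix.fromBlocks_mulVec, Sum.elim_comp_inl, Sum.elim_comp_inr, Matrix.mulVec_mulVec,
      Matrix.mul_nonsing_inv _ hR, Matrix.one_mulVec, sub_add_cancel, Matrix.zero_mulVec, add_zero,
      Matrix.mulVec_mulVec, Matrix.mulVec_sub, Matrix.mulVec_mulVec, hb, sub_sub_cancel]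
  rw [← hsolve, Matrix.mulVec_mulVec, Matrix.nonsing_inv_mul _ hu, Matrix.one_mulVec]

theorem sumElim_dotProduct_inv_fromBlocks_mulVec (hR : IsUnit R.det)
    (hG : IsUnit (Tᵀ * R⁻¹ * T).det) (y : ι → ℝ) :
    Sum.elim y 0 ⬝ᵥ ((Matrix.fromBlocks R T Tᵀ 0)⁻¹ *ᵥ Sum.elim y 0) = glsS2 T R y := by
  rw [inv_fromBlocks_transpose_zero_mulVec hR hG (by rw [mulVec_glsCoef hG, sub_zero]),
    sumElim_dotProduct_sumElim, zero_dotProduct, add_zero, glsS2_eq_dotProduct]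

end LeastSquares

section Bordered

variable {ι κ : Type*}

/-- Moves the distinguished index to the first summand. -/
def optionSumEquiv (ι κ : Type*) : Option (ι ⊕ κ) ≃ Option ι ⊕ κ where
  toFun o := o.elim (Sum.inl none) (Sum.map some id)
  invFun := Sum.elim (Option.map Sum.inl) (some ∘ Sum.inr)
  left_inv := by rintro (_ | _ | _) <;> rfl
  right_inv := by rintro ((_ | _) | _) <;> rfl

/-- The saddle-point matrix `[[Q, T], [Tᵀ, 0]]` of the regression enlarged by the index `none`,
arranged as a bordering of the saddle-point matrix of the regression on the other indices. -/
def borderedSaddle (T : Matrix (Option ι) κ ℝ) (Q : Matrix (Option ι) (Option ι) ℝ) :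
    Matrix (Option (ι ⊕ κ)) (Option (ι ⊕ κ)) ℝ :=
  (Matrix.fromBlocks Q T Tᵀ 0).submatrix (optionSumEquiv ι κ) (optionSumEquiv ι κ)

variable (T : Matrix (Option ι) κ ℝ) (Q : Matrix (Option ι) (Option ι) ℝ)

theorem isSymm_borderedSaddle {Q : Matrix (Option ι) (Option ι) ℝ} (hQ : Q.IsSymm) :
    (borderedSaddle T Q).IsSymm :=
  (hQ.fromBlocks rfl Matrix.isSymm_zero).submatrix _

theorem borderedSaddle_submatrix_some : (borderedSaddle T Q).submatrix some some =
    Matrix.fromBlocks (Q.submatrix some some) (T.submatrix some id) (T.submatrix some id)ᵀ 0 := by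
  ext (_ | _) (_ | _) <;> rfl

theorem borderedSaddle_some_none : (fun i => borderedSaddle T Q (some i) none) =
    Sum.elim (fun i => Q (some i) none) (T none) := by
  ext (_ | _) <;> rfl

theorem linearIndependent_col_of_submatrix_some {T : Matrix (Option ι) κ ℝ}
    (hT : LinearIndependent ℝ (T.submatrix some id).col) : LinearIndependent ℝ T.col :=
  .of_comp (LinearMap.funLeft ℝ ℝ some) hT

end Bordered

section Kriging

variable {ι κ : Type*} [Fintype ι] [DecidableEq ι] [Fintype κ] [DecidableEq κ]

/-- Best linear unbiased prediction of the observation at the index `none`, from the observations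
`y` at the other indices, in the regression with design matrix `T` and correlation matrix `Q`. -/
def krigingMean (T : Matrix (Option ι) κ ℝ) (Q : Matrix (Option ι) (Option ι) ℝ) (y : ι → ℝ) : ℝ :=
  T none ⬝ᵥ glsCoef (T.submatrix some id) (Q.submatrix some some) y +
    (fun i => Q (some i) none) ⬝ᵥ ((Q.submatrix some some)⁻¹ *ᵥ
      (y - T.submatrix some id *ᵥ glsCoef (T.submatrix some id) (Q.submatrix some some) y))

/-- Mean squared error of `krigingMean`, in units of the variance of the regression: the first term
is the error with known coefficients, the second one the price of estimating them. -/
def krigingVar (T : Matrix (Option ι) κ ℝ) (Q : Matrix (Option ι) (Option ι) ℝ) : ℝ :=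
  let R := Q.submatrix some some
  let T' := T.submatrix some id
  let g := T none - (T'ᵀ * R⁻¹) *ᵥ fun i => Q (some i) none
  schur Q + g ⬝ᵥ ((T'ᵀ * R⁻¹ * T')⁻¹ *ᵥ g)

variable {T : Matrix (Option ι) κ ℝ} {Q : Matrix (Option ι) (Option ι) ℝ}

theorem schur_borderedSaddle (hQ : Q.PosDef)
    (hT : LinearIndependent ℝ (T.submatrix some id).col) :
    schur (borderedSaddle T Q) = krigingVar T Q := by
  have hR := hQ.submatrix (Option.some_injective ι)
  have hG := (posDef_transpose_mul_inv_mul hR hT).det_pos.ne'.isUnit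
  simp only [schur, krigingVar, borderedSaddle_submatrix_some, borderedSaddle_some_none]
  set R := Q.submatrix some some
  set T' := T.submatrix some id
  set ρ : ι → ℝ := fun i => Q (some i) none
  set g := T none - (T'ᵀ * R⁻¹) *ᵥ ρ with hg
  set G := T'ᵀ * R⁻¹ * T'
  have hb : G *ᵥ -(G⁻¹ *ᵥ g) = (T'ᵀ * R⁻¹) *ᵥ ρ - T none := by
    rw [Matrix.mulVec_neg, Matrix.mulVec_mulVec, Matrix.mul_nonsing_inv _ hG, Matrix.one_mulVec,
      hg, neg_sub]
  have hswap (x : κ → ℝ) : ρ ⬝ᵥ (R⁻¹ *ᵥ (T' *ᵥ x)) = ((T'ᵀ * R⁻¹) *ᵥ ρ) ⬝ᵥ x := by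
    rw [Matrix.mulVec_mulVec, Matrix.dotProduct_mulVec, ← Matrix.mulVec_transpose,
      Matrix.transpose_mul, isSymm_of_posDef hR.inv]
  have hcorner : borderedSaddle T Q none none = Q none none := rfl
  rw [inv_fromBlocks_transpose_zero_mulVec hR.det_pos.ne'.isUnit hG hb, hcorner,
    sumElim_dotProduct_sumElim, Matrix.mulVec_neg, sub_neg_eq_add, Matrix.mulVec_add,
    dotProduct_add, hswap, dotProduct_neg]
  linear_combination -(sub_dotProduct (T none) ((T'ᵀ * R⁻¹) *ᵥ ρ) (G⁻¹ *ᵥ g))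

theorem det_borderedSaddle_submatrix_some (hQ : Q.PosDef) :
    ((borderedSaddle T Q).submatrix some some).det =
      (-1) ^ Fintype.card κ * ((Q.submatrix some some).det *
        ((T.submatrix some id)ᵀ * (Q.submatrix some some)⁻¹ * T.submatrix some id).det) := by
  rw [borderedSaddle_submatrix_some, det_fromBlocks_transpose_zero
    (hQ.submatrix (Option.some_injective ι)).det_pos.ne'.isUnit]

theorem isUnit_det_borderedSaddle_submatrix_some (hQ : Q.PosDef)
    (hT : LinearIndependent ℝ (T.submatrix some id).col) :
    IsUnit ((borderedSaddle T Q).submatrix some some).det := by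
  have hR := hQ.submatrix (Option.some_injective ι)
  rw [det_borderedSaddle_submatrix_some hQ]
  exact (isUnit_one.neg.pow _).mul (hR.det_pos.ne'.isUnit.mul
    (posDef_transpose_mul_inv_mul hR hT).det_pos.ne'.isUnit)

theorem det_mul_det_eq_mul_krigingVar (hQ : Q.PosDef)
    (hT : LinearIndependent ℝ (T.submatrix some id).col) :
    Q.det * (Tᵀ * Q⁻¹ * T).det = (Q.submatrix some some).det *
      ((T.submatrix some id)ᵀ * (Q.submatrix some some)⁻¹ * T.submatrix some id).det *
        krigingVar T Q := by
  have hborder := det_eq_det_mul_schur (isSymm_borderedSaddle T (isSymm_of_posDef hQ))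
    (isUnit_det_borderedSaddle_submatrix_some hQ hT)
  rw [det_borderedSaddle_submatrix_some hQ, schur_borderedSaddle hQ hT, borderedSaddle,
    Matrix.det_submatrix_equiv_self, det_fromBlocks_transpose_zero hQ.det_pos.ne'.isUnit,
    mul_assoc] at hborder
  exact mul_left_cancel₀ (pow_ne_zero _ (neg_ne_zero.2 one_ne_zero)) hborder

theorem krigingVar_pos (hQ : Q.PosDef) (hT : LinearIndependent ℝ (T.submatrix some id).col) :
    0 < krigingVar T Q := by
  have hR := hQ.submatrix (Option.some_injective ι)
  have hG := posDef_transpose_mul_inv_mul hR hT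
  have hGfull := posDef_transpose_mul_inv_mul hQ (linearIndependent_col_of_submatrix_some hT)
  have hprod := mul_pos hQ.det_pos hGfull.det_pos
  rw [det_mul_det_eq_mul_krigingVar hQ hT] at hprod
  exact pos_of_mul_pos_right hprod (mul_pos hR.det_pos hG.det_pos).le

theorem glsS2_option (hQ : Q.PosDef) (hT : LinearIndependent ℝ (T.submatrix some id).col)
    (y : Option ι → ℝ) :
    glsS2 T Q y = glsS2 (T.submatrix some id) (Q.submatrix some some) (y ∘ some) +
      (y none - krigingMean T Q (y ∘ some)) ^ 2 / krigingVar T Q := by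
  have hR := hQ.submatrix (Option.some_injective ι)
  have hG := (posDef_transpose_mul_inv_mul hR hT).det_pos.ne'.isUnit
  have hGfull := (posDef_transpose_mul_inv_mul hQ
    (linearIndependent_col_of_submatrix_some hT)).det_pos.ne'.isUnit
  set w := Sum.elim y 0 ∘ optionSumEquiv ι κ with hw
  have hfull : w ⬝ᵥ ((borderedSaddle T Q)⁻¹ *ᵥ w) = glsS2 T Q y := by
    rw [borderedSaddle, Matrix.inv_submatrix_equiv, Matrix.submatrix_mulVec_equiv, hw,
      Function.comp_assoc, Equiv.self_comp_symm, Function.comp_id, comp_equiv_dotProduct_comp_equiv,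
      sumElim_dotProduct_inv_fromBlocks_mulVec hQ.det_pos.ne'.isUnit hGfull]
  have hnone : w none = y none := rfl
  have hsome : w ∘ some = Sum.elim (y ∘ some) 0 := by ext (_ | _) <;> rfl
  have hborder := dotProduct_inv_mulVec_eq_add_sq_div_schur
    (isSymm_borderedSaddle T (isSymm_of_posDef hQ))
    (isUnit_det_borderedSaddle_submatrix_some hQ hT)
    (schur_borderedSaddle hQ hT ▸ (krigingVar_pos hQ hT).ne') w
  rwa [hfull, schur_borderedSaddle hQ hT, borderedSaddle_some_none, borderedSaddle_submatrix_some,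
    hnone, hsome, sumElim_dotProduct_inv_fromBlocks_mulVec hR.det_pos.ne'.isUnit hG,
    inv_fromBlocks_transpose_zero_mulVec hR.det_pos.ne'.isUnit hG
      (by rw [mulVec_glsCoef hG, sub_zero]),
    sumElim_dotProduct_sumElim, add_comm (_ ⬝ᵥ _) (T none ⬝ᵥ _)] at hborder

theorem glsS2_pos_of_submatrix_some (hQ : Q.PosDef)
    (hT : LinearIndependent ℝ (T.submatrix some id).col) {y : Option ι → ℝ}
    (hS : 0 < glsS2 (T.submatrix some id) (Q.submatrix some some) (y ∘ some)) :
    0 < glsS2 T Q y := by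
  rw [glsS2_option hQ hT]
  have := krigingVar_pos hQ hT
  positivity

end Kriging

section Evidence

variable {ι : Type*} [Fintype ι] [DecidableEq ι] {R : Matrix ι ι ℝ}

theorem normalPDF_smul (hR : R.PosDef) (v : ℝ) (m y : ι → ℝ) :
    normalPDF m (v • R) y =
      (√((2 * Real.pi) ^ Fintype.card ι * (v ^ Fintype.card ι * R.det)))⁻¹ *
        Real.exp (-(v⁻¹ * ((y - m) ⬝ᵥ (R⁻¹ *ᵥ (y - m)))) / 2) := by
  have hinv : (v • R)⁻¹ = v⁻¹ • R⁻¹ := by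
    rcases eq_or_ne v 0 with rfl | hv
    · simp
    · exact Matrix.inv_smul' R (Units.mk0 v hv) hR.det_pos.ne'.isUnit
  rw [normalPDF, Matrix.det_smul, hinv, Matrix.smul_mulVec, dotProduct_smul, smul_eq_mul]

theorem measurable_normalPDF_smul {α : Type*} [MeasurableSpace α] (hR : R.PosDef) {v : α → ℝ}
    {m : α → ι → ℝ} (hv : Measurable v) (hm : Measurable m) (y : ι → ℝ) :
    Measurable fun a => normalPDF (m a) (v a • R) y := by
  have hquad : Measurable fun z : ι → ℝ => (y - z) ⬝ᵥ (R⁻¹ *ᵥ (y - z)) :=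
    (Continuous.dotProduct (by fun_prop)
      (Continuous.matrix_mulVec continuous_const (by fun_prop))).measurable
  have hexponent := hquad.comp hm
  simp only [normalPDF_smul hR]
  simp only [Function.comp_def] at hexponent
  fun_prop

variable {κ : Type*} [Fintype κ] [DecidableEq κ] {T : Matrix ι κ ℝ}

/-- Marginal likelihood of the normal linear regression with design matrix `T` and correlation
matrix `R`, under the prior that is flat in the coefficients and `1 / v` in the variance. -/
def evidence (T : Matrix ι κ ℝ) (R : Matrix ι ι ℝ) (y : ι → ℝ) : ℝ :=
  let ν : ℝ := Fintype.card ι - Fintype.card κ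
  Real.Gamma (ν / 2) * (Real.pi * glsS2 T R y) ^ (-(ν / 2)) / √(R.det * (Tᵀ * R⁻¹ * T).det)

theorem normalPDF_mulVec_eq_mul_normalPDF_glsCoef (hR : R.PosDef)
    (hT : LinearIndependent ℝ T.col) {k : ℕ} (hk : Fintype.card ι = Fintype.card κ + k) {v : ℝ}
    (hv : 0 < v) (b : κ → ℝ) (y : ι → ℝ) :
    normalPDF (T *ᵥ b) (v • R) y =
      (√((2 * Real.pi) ^ k * v ^ k * (R.det * (Tᵀ * R⁻¹ * T).det)))⁻¹ *
        Real.exp (-(glsS2 T R y / 2 / v)) *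
          normalPDF (glsCoef T R y) (v • (Tᵀ * R⁻¹ * T)⁻¹) b := by
  have hG := posDef_transpose_mul_inv_mul hR hT
  have hRdet := hR.det_pos
  have hGdet := hG.det_pos
  rw [normalPDF_smul hR, normalPDF_smul hG.inv, dotProduct_residual hR hT, Matrix.det_nonsing_inv,
    Matrix.nonsing_inv_nonsing_inv _ hGdet.ne'.isUnit, Ring.inverse_eq_inv', hk]
  set D := (Tᵀ * R⁻¹ * T).det
  have hsqrt : √((2 * Real.pi) ^ (Fintype.card κ + k) * (v ^ (Fintype.card κ + k) * R.det)) =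
      √((2 * Real.pi) ^ k * v ^ k * (R.det * D)) *
        √((2 * Real.pi) ^ Fintype.card κ * (v ^ Fintype.card κ * D⁻¹)) := by
    rw [← Real.sqrt_mul (by positivity)]
    congr 1
    field_simp
    ring
  rw [hsqrt, mul_inv, mul_add, neg_add, add_div, Real.exp_add, neg_div, neg_div]
  ring_nf

theorem lintegral_normalPDF_mulVec (hR : R.PosDef) (hT : LinearIndependent ℝ T.col) {k : ℕ}
    (hk : Fintype.card ι = Fintype.card κ + k) {v : ℝ} (hv : 0 < v) (y : ι → ℝ) :
    ∫⁻ b, ENNReal.ofReal (normalPDF (T *ᵥ b) (v • R) y) =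
      ENNReal.ofReal ((√((2 * Real.pi) ^ k * v ^ k * (R.det * (Tᵀ * R⁻¹ * T).det)))⁻¹ *
        Real.exp (-(glsS2 T R y / 2 / v))) := by
  have hG := posDef_transpose_mul_inv_mul hR hT
  have hnonneg : 0 ≤ (√((2 * Real.pi) ^ k * v ^ k * (R.det * (Tᵀ * R⁻¹ * T).det)))⁻¹ *
      Real.exp (-(glsS2 T R y / 2 / v)) := by positivity
  simp_rw [normalPDF_mulVec_eq_mul_normalPDF_glsCoef hR hT hk hv, ENNReal.ofReal_mul hnonneg]
  rw [lintegral_const_mul' _ _ ENNReal.ofReal_ne_top, lintegral_normalPDF _ (hG.inv.smul hv),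
    mul_one]

/-- The improper prior `1 / v` of a variance `v`. -/
def variancePrior : Measure ℝ :=
  (volume.restrict (Set.Ioi (0 : ℝ))).withDensity fun v => ENNReal.ofReal (1 / v)

instance : SigmaFinite variancePrior := by
  unfold variancePrior
  infer_instance

theorem lintegral_variancePrior (f : ℝ → ℝ≥0∞) :
    ∫⁻ v, f v ∂variancePrior = ∫⁻ v in Set.Ioi (0 : ℝ), ENNReal.ofReal (1 / v) * f v :=
  lintegral_withDensity_eq_lintegral_mul_non_measurable _ (by fun_prop)
    (.of_forall fun _ => ENNReal.ofReal_lt_top) _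

theorem lintegral_normalPDF_mulVec_variancePrior (hR : R.PosDef) (hT : LinearIndependent ℝ T.col)
    {y : ι → ℝ} (hS : 0 < glsS2 T R y) :
    ∫⁻ v, (∫⁻ b, ENNReal.ofReal (normalPDF (T *ᵥ b) (v • R) y)) ∂variancePrior =
      ENNReal.ofReal (evidence T R y) := by
  obtain ⟨k, hk⟩ := Nat.exists_eq_add_of_le (card_lt_card_of_glsS2_pos hR hT hS).le
  have hkpos : 0 < (k : ℝ) := by
    have := card_lt_card_of_glsS2_pos hR hT hS
    exact_mod_cast (by omega : 0 < k)
  have hD := mul_pos hR.det_pos (posDef_transpose_mul_inv_mul hR hT).det_pos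
  set D := R.det * (Tᵀ * R⁻¹ * T).det with hDdef
  have hsqrt (x : ℝ) (hx : 0 < x) : √(x ^ k) = x ^ ((k : ℝ) / 2) := by
    rw [Real.sqrt_eq_rpow, ← Real.rpow_natCast, ← Real.rpow_mul hx.le, mul_one_div]
  have hpointwise (v : ℝ) (hv : 0 < v) :
      ENNReal.ofReal (1 / v) * ∫⁻ b, ENNReal.ofReal (normalPDF (T *ᵥ b) (v • R) y) =
        ENNReal.ofReal ((2 * Real.pi) ^ (-((k : ℝ) / 2)) / √D) *
          ENNReal.ofReal (v ^ (-((k : ℝ) / 2) - 1) * Real.exp (-(glsS2 T R y / 2 / v))) := by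
    rw [lintegral_normalPDF_mulVec hR hT hk hv, ← ENNReal.ofReal_mul (by positivity),
      ← ENNReal.ofReal_mul (by positivity), ← hDdef, Real.sqrt_mul (by positivity),
      Real.sqrt_mul (by positivity), hsqrt _ Real.two_pi_pos, hsqrt v hv, Real.rpow_sub_one hv.ne',
      Real.rpow_neg hv.le, Real.rpow_neg Real.two_pi_pos.le]
    congr 1
    field_simp
  have hpow : (Real.pi * glsS2 T R y) ^ (-((k : ℝ) / 2)) =
      (2 * Real.pi) ^ (-((k : ℝ) / 2)) * (glsS2 T R y / 2) ^ (-((k : ℝ) / 2)) := by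
    rw [← Real.mul_rpow (by positivity) (by positivity)]
    ring_nf
  rw [lintegral_variancePrior, setLIntegral_congr_fun measurableSet_Ioi hpointwise,
    lintegral_const_mul' _ _ ENNReal.ofReal_ne_top,
    lintegral_inverseGamma (by positivity) (by positivity), ← ENNReal.ofReal_mul (by positivity),
    evidence, hk, Nat.cast_add, add_sub_cancel_left, hpow]
  congr 1
  ring

theorem evidence_pos (hR : R.PosDef) (hT : LinearIndependent ℝ T.col) {y : ι → ℝ}
    (hS : 0 < glsS2 T R y) : 0 < evidence T R y := by
  have hν : 0 < ((Fintype.card ι : ℝ) - Fintype.card κ) / 2 :=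
    half_pos (sub_pos.2 (by exact_mod_cast card_lt_card_of_glsS2_pos hR hT hS))
  have hD := mul_pos hR.det_pos (posDef_transpose_mul_inv_mul hR hT).det_pos
  unfold evidence
  positivity

theorem evidence_option {T : Matrix (Option ι) κ ℝ} {Q : Matrix (Option ι) (Option ι) ℝ}
    (hQ : Q.PosDef) (hT : LinearIndependent ℝ (T.submatrix some id).col) {y : Option ι → ℝ}
    (hS : 0 < glsS2 (T.submatrix some id) (Q.submatrix some some) (y ∘ some)) :
    evidence T Q y = evidence (T.submatrix some id) (Q.submatrix some some) (y ∘ some) *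
      studentPDF (Fintype.card ι - Fintype.card κ) (krigingMean T Q (y ∘ some))
        (glsS2 (T.submatrix some id) (Q.submatrix some some) (y ∘ some) /
          (Fintype.card ι - Fintype.card κ) * krigingVar T Q) (y none) := by
  have hR := hQ.submatrix (Option.some_injective ι)
  have hcard := card_lt_card_of_glsS2_pos hR hT hS
  obtain ⟨ν, hνdef⟩ : ∃ ν : ℝ, ν = Fintype.card ι - Fintype.card κ := ⟨_, rfl⟩
  have hν : 0 < ν := hνdef ▸ sub_pos.2 (by exact_mod_cast hcard)
  have hc := krigingVar_pos hQ hT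
  have hD := mul_pos hR.det_pos (posDef_transpose_mul_inv_mul hR hT).det_pos
  have hνoption : (Fintype.card (Option ι) : ℝ) - Fintype.card κ = ν + 1 := by
    rw [hνdef, Fintype.card_option]
    push_cast
    ring
  simp only [evidence, hνoption, det_mul_det_eq_mul_krigingVar hQ hT, glsS2_option hQ hT, ← hνdef]
  set S := glsS2 (T.submatrix some id) (Q.submatrix some some) (y ∘ some)
  set c := krigingVar T Q
  set e := y none - krigingMean T Q (y ∘ some) with he
  have hS' : Real.pi * (S + e ^ 2 / c) = Real.pi * S * (1 + e ^ 2 / (ν * (S / ν * c))) := by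
    field_simp
  have hpow : (Real.pi * S) ^ (-((ν + 1) / 2)) = (Real.pi * S) ^ (-(ν / 2)) / √(Real.pi * S) := by
    rw [Real.sqrt_eq_rpow, ← Real.rpow_sub (by positivity)]
    ring_nf
  have hsqrt : √(ν * Real.pi * (S / ν * c)) = √(Real.pi * S) * √c := by
    rw [← Real.sqrt_mul (by positivity)]
    congr 1
    field_simp
  rw [studentPDF, ← he, hS', Real.mul_rpow (by positivity) (by positivity), hpow, hsqrt,
    Real.sqrt_mul hD.le]
  field_simp

end Evidence

section Predictive

variable {d s : ℕ} {𝒳 : Set (EuclideanSpace ℝ (Fin d))} {S : Setup d s 𝒳} {Y : S.Data}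

theorem Setup.posDef_R (hR : ∀ t, (S.Rfull t).PosDef) (t : Fin s) : (S.R t).PosDef :=
  (hR t).submatrix (Option.some_injective (S.aug t))

theorem Setup.dof_pos (hR : ∀ t, (S.Rfull t).PosDef) (hY : S.Regular Y) (t : Fin s) :
    0 < S.dof t := by
  classical
  have hcard := card_lt_card_of_glsS2_pos (posDef_R hR t) (hY t).1 (hY t).2
  rw [Fintype.card_coe] at hcard
  exact sub_pos.2 (by exact_mod_cast hcard)

open Classical in
theorem Setup.c_eq_krigingVar (t : Fin s) (Y : S.Data) (y0 : Fin s → ℝ) :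
    S.c t Y y0 = krigingVar (S.Tfull t Y y0) (S.Rfull t) := rfl

theorem Setup.scale_pos (hR : ∀ t, (S.Rfull t).PosDef) (hY : S.Regular Y) (t : Fin s)
    (y0 : Fin s → ℝ) : 0 < S.scale t Y y0 := by
  classical
  refine mul_pos (div_pos (hY t).2 (dof_pos hR hY t)) ?_
  rw [c_eq_krigingVar]
  exact krigingVar_pos (hR t) (hY t).1

theorem Setup.dependsOn_T0 (t : Fin s) : DependsOn (S.T0 t) (Set.Iio t) := by
  rintro y0 y0' h
  ext (i | u)
  · rfl
  · exact h u.1 (Fin.lt_def.2 (by have := u.2; omega))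

theorem Setup.dependsOn_location (t : Fin s) : DependsOn (S.location t Y) (Set.Iio t) :=
  fun _ _ h => by simp only [location, dependsOn_T0 t h]

theorem Setup.dependsOn_scale (t : Fin s) : DependsOn (S.scale t Y) (Set.Iio t) :=
  fun _ _ h => by simp only [scale, c, dependsOn_T0 t h]

theorem Setup.continuous_T0 (t : Fin s) : Continuous (S.T0 t) := by
  refine continuous_pi ?_
  rintro (i | u)
  · exact continuous_const
  · exact continuous_apply u.1

theorem Setup.continuous_location (t : Fin s) : Continuous (S.location t Y) :=
  ((continuous_T0 t).dotProduct continuous_const).add continuous_const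

theorem Setup.continuous_scale (t : Fin s) : Continuous (S.scale t Y) := by
  have hres : Continuous fun y0 => S.T0 t y0 - ((S.T t Y)ᵀ * (S.R t)⁻¹) *ᵥ S.r0 t :=
    (continuous_T0 t).sub continuous_const
  exact continuous_const.mul
    (continuous_const.add (hres.dotProduct (continuous_const.matrix_mulVec hres)))

variable (Y) in
/-- The Student-t density that level `t` contributes to the predictive density at `y0`. -/
def Setup.levelDensity (t : Fin s) (y0 : Fin s → ℝ) : ℝ≥0∞ :=
  ENNReal.ofReal (studentPDF (S.dof t) (S.location t Y y0) (S.scale t Y y0) (y0 t))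

theorem Setup.measurable_levelDensity (t : Fin s) : Measurable (S.levelDensity Y t) := by
  have hlocation := (continuous_location (Y := Y) t).measurable
  have hscale := (continuous_scale (Y := Y) t).measurable
  unfold levelDensity
  fun_prop

theorem Setup.levelDensity_pos (hR : ∀ t, (S.Rfull t).PosDef) (hY : S.Regular Y) (t : Fin s)
    (y0 : Fin s → ℝ) : 0 < S.levelDensity Y t y0 :=
  ENNReal.ofReal_pos.2 (studentPDF_pos (dof_pos hR hY t) (scale_pos hR hY t y0) _)

theorem Setup.dependsOn_levelDensity (t : Fin s) : DependsOn (S.levelDensity Y t) (Set.Iic t) := by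
  intro y0 y0' h
  have hlt : ∀ k ∈ Set.Iio t, y0 k = y0' k := fun k hk => h k (Set.Iio_subset_Iic_self hk)
  rw [levelDensity, levelDensity, dependsOn_location t hlt, dependsOn_scale t hlt,
    h t Set.self_mem_Iic]

theorem Setup.levelDensity_update_self (t : Fin s) (y0 : Fin s → ℝ) (u : ℝ) :
    S.levelDensity Y t (Function.update y0 t u) =
      ENNReal.ofReal (studentPDF (S.dof t) (S.location t Y y0) (S.scale t Y y0) u) := by
  have hlt : ∀ k ∈ Set.Iio t, Function.update y0 t u k = y0 k := fun k hk =>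
    Function.update_of_ne (ne_of_lt hk) _ _
  rw [levelDensity, dependsOn_location t hlt, dependsOn_scale t hlt, Function.update_self]

theorem Setup.lmarginal_prod_levelDensity (hR : ∀ t, (S.Rfull t).PosDef) (hY : S.Regular Y)
    {U : Finset (Fin s)} (hU : IsUpperSet (U : Set (Fin s))) (y0 : Fin s → ℝ) :
    lmarginal (fun _ => volume) U (fun z => ∏ t, S.levelDensity Y t z) y0 =
      ∏ t ∈ Uᶜ, S.levelDensity Y t y0 := by
  rw [lmarginal_prod_of_isUpperSet (c := fun _ => 1) measurable_levelDensity
    dependsOn_levelDensity _ hU, Finset.prod_const_one, one_mul]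
  intro t z
  simp_rw [levelDensity_update_self]
  exact lintegral_studentPDF (dof_pos hR hY t) (scale_pos hR hY t z) _

theorem Setup.lintegral_prod_levelDensity (hR : ∀ t, (S.Rfull t).PosDef) (hY : S.Regular Y) :
    ∫⁻ y0, ∏ t, S.levelDensity Y t y0 = 1 := by
  rw [volume_pi, lintegral_eq_lmarginal_univ 0,
    lmarginal_prod_levelDensity hR hY (by simp [isUpperSet_univ]), Finset.compl_univ,
    Finset.prod_empty]

open Classical in
theorem Setup.marginal_eq_prod_evidence (hR : ∀ t, (S.Rfull t).PosDef) (hY : S.Regular Y)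
    (y0 : Fin s → ℝ) :
    S.marginal Y y0 =
      ∏ t, ENNReal.ofReal (evidence (S.Tfull t Y y0) (S.Rfull t) (S.yfull t Y y0)) := by
  have hmean (t : Fin s) : Measurable fun p : (S.Reg t → ℝ) × ℝ => S.Tfull t Y y0 *ᵥ p.1 :=
    (measurable_mulVec (S.Tfull t Y y0)).comp measurable_fst
  have hmeas (t : Fin s) : Measurable fun p : (S.Reg t → ℝ) × ℝ => ENNReal.ofReal
      (normalPDF (S.Tfull t Y y0 *ᵥ p.1) (p.2 • S.Rfull t) (S.yfull t Y y0)) :=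
    (measurable_normalPDF_smul (hR t) measurable_snd (hmean t) _).ennreal_ofReal
  refine (lintegral_pi_prod_pi_prod (μ := fun _ => volume) (ν := fun _ => variancePrior)
    hmeas).trans (Finset.prod_congr rfl fun t _ => ?_)
  have hT : LinearIndependent ℝ ((S.Tfull t Y y0).submatrix some id).col := (hY t).1
  exact lintegral_normalPDF_mulVec_variancePrior (hR t)
    (linearIndependent_col_of_submatrix_some hT)
    (glsS2_pos_of_submatrix_some (hR t) hT (y := S.yfull t Y y0) (hY t).2)

open Classical in
theorem Setup.evidence_pos (hR : ∀ t, (S.Rfull t).PosDef) (hY : S.Regular Y) (t : Fin s) :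
    0 < evidence (S.T t Y) (S.R t) (Y t) :=
  PPCokriging.evidence_pos (posDef_R hR t) (hY t).1 (hY t).2

open Classical in
theorem Setup.ofReal_evidence_full (hR : ∀ t, (S.Rfull t).PosDef) (hY : S.Regular Y) (t : Fin s)
    (y0 : Fin s → ℝ) :
    ENNReal.ofReal (evidence (S.Tfull t Y y0) (S.Rfull t) (S.yfull t Y y0)) =
      ENNReal.ofReal (evidence (S.T t Y) (S.R t) (Y t)) * S.levelDensity Y t y0 := by
  have hT : LinearIndependent ℝ ((S.Tfull t Y y0).submatrix some id).col := (hY t).1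
  rw [evidence_option (hR t) hT (y := S.yfull t Y y0) (hY t).2, Fintype.card_coe]
  exact ENNReal.ofReal_mul (evidence_pos hR hY t).le

theorem Setup.predictiveDensity_eq (hR : ∀ t, (S.Rfull t).PosDef) (hY : S.Regular Y) :
    S.predictiveDensity Y = fun y0 => ∏ t, S.levelDensity Y t y0 := by
  classical
  have hne_zero : ∏ t, ENNReal.ofReal (evidence (S.T t Y) (S.R t) (Y t)) ≠ 0 :=
    Finset.prod_ne_zero_iff.2 fun t _ => (ENNReal.ofReal_pos.2 (evidence_pos hR hY t)).ne'
  have hne_top : ∏ t, ENNReal.ofReal (evidence (S.T t Y) (S.R t) (Y t)) ≠ ∞ :=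
    ENNReal.prod_ne_top fun t _ => ENNReal.ofReal_ne_top
  have hmarginal (y0 : Fin s → ℝ) : S.marginal Y y0 =
      (∏ t, ENNReal.ofReal (evidence (S.T t Y) (S.R t) (Y t))) * ∏ t, S.levelDensity Y t y0 := by
    rw [marginal_eq_prod_evidence hR hY, ← Finset.prod_mul_distrib]
    exact Finset.prod_congr rfl fun t _ => ofReal_evidence_full hR hY t y0
  ext y0
  simp only [predictiveDensity, hmarginal]
  rw [lintegral_const_mul' _ _ hne_top, lintegral_prod_levelDensity hR hY,
    ENNReal.mul_div_mul_left _ _ hne_zero hne_top, div_one]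

theorem Setup.condDensity_eq (hR : ∀ t, (S.Rfull t).PosDef) (hY : S.Regular Y) (t : Fin s)
    (y0 : Fin s → ℝ) (u : ℝ) :
    S.condDensity t Y y0 u =
      ENNReal.ofReal (studentPDF (S.dof t) (S.location t Y y0) (S.scale t Y y0) u) := by
  have hIoi : (Finset.Ioi t)ᶜ = insert t (Finset.Iio t) := by ext; simp
  have hIci : (Finset.Ici t)ᶜ = Finset.Iio t := by ext; simp
  have hlower : ∏ k ∈ Finset.Iio t, S.levelDensity Y k (Function.update y0 t u) =
      ∏ k ∈ Finset.Iio t, S.levelDensity Y k y0 :=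
    Finset.prod_congr rfl fun k hk => dependsOn_levelDensity k fun l hl =>
      Function.update_of_ne (ne_of_lt (lt_of_le_of_lt hl (Finset.mem_Iio.1 hk))) _ _
  have hne_zero : ∏ k ∈ Finset.Iio t, S.levelDensity Y k y0 ≠ 0 :=
    Finset.prod_ne_zero_iff.2 fun k _ => (levelDensity_pos hR hY k y0).ne'
  have hne_top : ∏ k ∈ Finset.Iio t, S.levelDensity Y k y0 ≠ ∞ :=
    ENNReal.prod_ne_top fun k _ => ENNReal.ofReal_ne_top
  rw [condDensity, predictiveDensity_eq hR hY,
    lmarginal_prod_levelDensity hR hY (Finset.coe_Ioi t ▸ isUpperSet_Ioi t),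
    lmarginal_prod_levelDensity hR hY (Finset.coe_Ici t ▸ isUpperSet_Ici t), hIoi, hIci,
    Finset.prod_insert Finset.notMem_Iio_self, hlower, levelDensity_update_self,
    ENNReal.mul_div_cancel_right hne_zero hne_top]

theorem Setup.isProbabilityMeasure_predictive (hR : ∀ t, (S.Rfull t).PosDef)
    (hY : S.Regular Y) : IsProbabilityMeasure (S.predictive Y) where
  measure_univ := by
    rw [predictive, predictiveDensity_eq hR hY, withDensity_apply _ MeasurableSet.univ,
      Measure.restrict_univ, lintegral_prod_levelDensity hR hY]

theorem Setup.predictive_eq_withDensity_prod_condDensity (hR : ∀ t, (S.Rfull t).PosDef)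
    (hY : S.Regular Y) :
    S.predictive Y = volume.withDensity fun y0 => ∏ t, S.condDensity t Y y0 (y0 t) := by
  simp_rw [condDensity_eq hR hY]
  rw [predictive, predictiveDensity_eq hR hY]
  rfl

theorem Setup.condPredictive_eq_studentT (hR : ∀ t, (S.Rfull t).PosDef)
    (hY : S.Regular Y) (t : Fin s) (y0 : Fin s → ℝ) :
    S.condPredictive t Y y0 = studentT (S.dof t) (S.location t Y y0) (S.scale t Y y0) :=
  congrArg volume.withDensity (funext (condDensity_eq hR hY t y0))

end Predictive

section Sampling

variable {d s : ℕ} {𝒳 : Set (EuclideanSpace ℝ (Fin d))}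

/-- Outputs at one spatial coordinate on the augmented designs enlarged by the new input. -/
abbrev Setup.Outputs (S : Setup d s 𝒳) : Type := (t : Fin s) → Option (S.aug t) → ℝ

/-- The point of the enlarged design of level `t - 1` that is the same input as the point `a` of
the enlarged design of level `t`. -/
def Setup.lower (S : Setup d s 𝒳) {t : Fin s} (u : Pred t) :
    Option (S.aug t) → Option (S.aug u.1) :=
  Option.map fun x => ⟨x.1, S.aug_subset u.2 x.2⟩

/-- The autoregressive part `γ_{t-1} y_{t-1}` of the outputs, so that `(1 - lag) y` is the family
of discrepancies on the enlarged designs. -/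
def Setup.lag (S : Setup d s 𝒳) (θ : S.Params) : Module.End ℝ S.Outputs where
  toFun w t a := ∑ u : Pred t, θ.1 t (Sum.inr u) * w u.1 (S.lower u a)
  map_add' w w' := by
    ext t a
    simp [mul_add, Finset.sum_add_distrib]
  map_smul' c w := by
    ext t a
    simp [Finset.mul_sum, mul_left_comm]

/-- The identification of data and outputs at the new input with outputs on the enlarged
designs. -/
def Setup.stack (S : Setup d s 𝒳) : S.Data × (Fin s → ℝ) ≃ᵐ S.Outputs where
  toFun p t := S.yfull t p.1 p.2
  invFun w := (fun t x => w t (some x), fun t => w t none)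
  left_inv _ := rfl
  right_inv w := by
    ext t a
    cases a <;> rfl
  measurable_toFun := measurable_pi_lambda _ fun t => measurable_pi_lambda _ fun a => by
    cases a with
    | none => exact (measurable_pi_apply t).comp measurable_snd
    | some x => exact (measurable_pi_apply x).comp ((measurable_pi_apply t).comp measurable_fst)
  measurable_invFun := Measurable.prodMk (f := fun (w : S.Outputs) t x => w t (some x))
    (g := fun (w : S.Outputs) t => w t none) (by fun_prop) (by fun_prop)

variable {S : Setup d s 𝒳}

theorem Setup.pt_lower {t : Fin s} (u : Pred t) (a : Option (S.aug t)) :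
    S.pt u.1 (S.lower u a) = S.pt t a := by
  cases a <;> rfl

theorem Setup.lag_apply (θ : S.Params) (w : S.Outputs) (t : Fin s) (a : Option (S.aug t)) :
    S.lag θ w t a = ∑ u : Pred t, θ.1 t (Sum.inr u) * w u.1 (S.lower u a) :=
  rfl

theorem Setup.isNilpotent_lag (θ : S.Params) : IsNilpotent (S.lag θ) := by
  have hvanish (k : ℕ) (w : S.Outputs) (t : Fin s) (htk : t.val < k) :
      (S.lag θ ^ k) w t = 0 := by
    induction k generalizing t with
    | zero => exact absurd htk (Nat.not_lt_zero _)
    | succ k ih =>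
      ext a
      rw [pow_succ', Module.End.mul_apply, lag_apply]
      refine Finset.sum_eq_zero fun u _ => ?_
      rw [ih u.1 (by have := u.2; omega), Pi.zero_apply, mul_zero]
  refine ⟨s, LinearMap.ext fun w => funext fun t => ?_⟩
  exact hvanish s w t t.2

theorem Setup.measurePreserving_stack :
    MeasurePreserving S.stack (volume.prod volume) volume := by
  have hoption (t : Fin s) := MeasurePreserving.mk (MeasurableEquiv.measurable _)
    (Measure.pi_map_piOptionEquivProd fun _ : Option (S.aug t) => (volume : Measure ℝ))
  have hstack : S.stack = (fun q t => (MeasurableEquiv.piOptionEquivProd fun _ => ℝ).symm (q t)) ∘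
      fun (p : S.Data × (Fin s → ℝ)) t => (p.1 t, p.2 t) := by
    ext p t a
    cases a <;> rfl
  rw [hstack]
  exact (measurePreserving_pi _ _ hoption).comp measurePreserving_pi_prod_pi

/-- The correspondence between outputs and discrepancies on the enlarged designs. -/
def Setup.discrepancyEquiv (S : Setup d s 𝒳) (θ : S.Params) :
    S.Data × (Fin s → ℝ) ≃ᵐ S.Outputs :=
  S.stack.trans (LinearMap.equivOfDetNeZero (1 - S.lag θ) (by
    rw [det_one_sub_of_isNilpotent (isNilpotent_lag θ)]
    exact one_ne_zero)).toContinuousLinearEquiv.toHomeomorph.toMeasurableEquiv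

theorem Setup.discrepancyEquiv_apply (θ : S.Params) (p : S.Data × (Fin s → ℝ)) :
    S.discrepancyEquiv θ p = S.stack p - S.lag θ (S.stack p) :=
  rfl

theorem Setup.measurePreserving_discrepancyEquiv (θ : S.Params) :
    MeasurePreserving (S.discrepancyEquiv θ) (volume.prod volume) volume :=
  (measurePreserving_one_sub_of_isNilpotent volume (isNilpotent_lag θ)).comp
    measurePreserving_stack

theorem Setup.discrepancyEquiv_observe {Ω : Type*} (y : Fin s → 𝒳 → Ω → ℝ) (θ : S.Params) (ω : Ω)
    (t : Fin s) (a : Option (S.aug t)) :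
    S.discrepancyEquiv θ (S.observe y ω) t a = S.discrepancy y θ t (S.pt t a) ω := by
  have hstack (t : Fin s) (a : Option (S.aug t)) :
      S.stack (S.observe y ω) t a = y t (S.pt t a) ω := by
    cases a <;> rfl
  simp only [discrepancyEquiv_apply, Pi.sub_apply, lag_apply, hstack, pt_lower, discrepancy]

/-- The mean of the discrepancies of level `t` on the enlarged design. -/
def Setup.discrepancyMean (S : Setup d s 𝒳) (θ : S.Params) (t : Fin s)
    (a : Option (S.aug t)) : ℝ :=
  ∑ i, S.h t (S.pt t a) i * θ.1 t (Sum.inl i)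

theorem Setup.discrepancyEquiv_sub_discrepancyMean (θ : S.Params) (Y : S.Data) (y0 : Fin s → ℝ)
    (t : Fin s) :
    S.discrepancyEquiv θ (Y, y0) t - S.discrepancyMean θ t =
      S.yfull t Y y0 - S.Tfull t Y y0 *ᵥ θ.1 t := by
  have hdesign : S.Tfull t Y y0 *ᵥ θ.1 t =
      S.lag θ (S.stack (Y, y0)) t + S.discrepancyMean θ t := by
    ext a
    rw [Matrix.mulVec, dotProduct, Fintype.sum_sum_type, add_comm]
    cases a <;> exact congrArg (· + _) (Finset.sum_congr rfl fun u _ => mul_comm _ _)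
  rw [hdesign, ← sub_sub]
  rfl

section Model

variable {N : ℕ} {Ω : Type*} [MeasurableSpace Ω] {y : Fin N → Fin s → 𝒳 → Ω → ℝ}
  {P : (Fin N → S.Params) → Measure Ω}

theorem Setup.IsModel.measurable_observe (hmodel : S.IsModel y P) (j : Fin N) :
    Measurable (S.observe (y j)) :=
  Measurable.prodMk
    (measurable_pi_lambda _ fun t => measurable_pi_lambda _ fun x => hmodel.measurable j t x)
    (measurable_pi_lambda _ fun t => hmodel.measurable j t S.x0)

open Classical in
theorem Setup.IsModel.map_discrepancy_level (hmodel : S.IsModel y P)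
    (hR : ∀ t, (S.Rfull t).PosDef) {θ : Fin N → S.Params} (hθ : ∀ i t, 0 < (θ i).2 t)
    (j : Fin N) (t : Fin s) :
    (P θ).map (fun ω a => S.discrepancy (y j) (θ j) t (S.pt t a) ω) =
      volume.withDensity fun w => ENNReal.ofReal
        (normalPDF (S.discrepancyMean (θ j) t) ((θ j).2 t • S.Rfull t) w) := by
  have hgp := hmodel.isGP θ hθ j t
  have hlaw := (hgp.isGaussianProcess.comp_right (S.pt t)).hasGaussianLaw Finset.univ
  refine map_eq_withDensity_normalPDF ?_ (fun a => hgp.mean _) (fun a a' => hgp.cov _ _)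
    ((hR t).smul (hθ j t))
  exact hlaw.map_fun (ContinuousLinearMap.pi fun a => ContinuousLinearMap.proj
    (R := ℝ) (φ := fun _ : (Finset.univ : Finset (Option (S.aug t))) => ℝ) ⟨a, Finset.mem_univ a⟩)

open Classical in
theorem Setup.IsModel.map_discrepancy (hmodel : S.IsModel y P)
    (hR : ∀ t, (S.Rfull t).PosDef) {θ : Fin N → S.Params} (hθ : ∀ i t, 0 < (θ i).2 t)
    (j : Fin N) :
    (P θ).map (fun ω (t : Fin s) a => S.discrepancy (y j) (θ j) t (S.pt t a) ω) =
      volume.withDensity fun w => ∏ t, ENNReal.ofReal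
        (normalPDF (S.discrepancyMean (θ j) t) ((θ j).2 t • S.Rfull t) (w t)) := by
  have hP := hmodel.isProbabilityMeasure θ hθ
  have hmeas (t : Fin s) : Measurable fun ω (a : Option (S.aug t)) =>
      S.discrepancy (y j) (θ j) t (S.pt t a) ω := by
    have := hmodel.measurable j
    unfold discrepancy
    fun_prop
  have hindep : iIndepFun (fun (t : Fin s) ω (a : Option (S.aug t)) =>
      S.discrepancy (y j) (θ j) t (S.pt t a) ω) (P θ) :=
    ((hmodel.indep θ hθ).precomp (g := fun t => (j, t)) fun _ _ h => (Prod.mk.inj h).2).comp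
      (fun t z a => z (S.pt t a)) fun t => by fun_prop
  have (t : Fin s) : SigmaFinite ((volume : Measure (Option (S.aug t) → ℝ)).withDensity fun w =>
      ENNReal.ofReal (normalPDF (S.discrepancyMean (θ j) t) ((θ j).2 t • S.Rfull t) w)) :=
    have := isProbabilityMeasure_normalPDF (S.discrepancyMean (θ j) t) ((hR t).smul (hθ j t))
    inferInstance
  rw [(iIndepFun_iff_map_fun_eq_pi_map fun t => (hmeas t).aemeasurable).1 hindep]
  simp_rw [hmodel.map_discrepancy_level hR hθ j]
  rw [pi_withDensity fun t => by fun_prop, ← volume_pi]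

theorem Setup.IsModel.map_observe (hmodel : S.IsModel y P) (hR : ∀ t, (S.Rfull t).PosDef)
    {θ : Fin N → S.Params} (hθ : ∀ i t, 0 < (θ i).2 t) (j : Fin N) :
    (P θ).map (S.observe (y j)) = volume.withDensity fun a => S.sampling (θ j) a.1 a.2 := by
  have hcomp : S.discrepancyEquiv (θ j) ∘ S.observe (y j) =
      fun ω t a => S.discrepancy (y j) (θ j) t (S.pt t a) ω :=
    funext fun ω => funext fun t => funext (discrepancyEquiv_observe (y j) (θ j) ω t)
  rw [map_eq_withDensity_of_map_comp_eq (measurePreserving_discrepancyEquiv (θ j))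
    (hmodel.measurable_observe j) (by fun_prop) (hcomp ▸ hmodel.map_discrepancy hR hθ j)]
  congr 1 with ⟨Y, y0⟩
  simp only [Function.comp_apply, sampling, normalPDF, discrepancyEquiv_sub_discrepancyMean]

end Model

end Sampling

end PPCokriging

end

theorem proposition1 {d s N : ℕ} {𝒳 : Set (EuclideanSpace ℝ (Fin d))}
    (S : PPCokriging.Setup d s 𝒳)
    (hx0 : ∀ t, S.x0 ∉ S.aug t)
    (hR : ∀ t, (S.Rfull t).PosDef)
    {Ω : Type*} [MeasurableSpace Ω]
    (y : Fin N → Fin s → 𝒳 → Ω → ℝ) (P : (Fin N → S.Params) → Measure Ω)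
    (hmodel : S.IsModel y P) (j : Fin N) :
    (∀ θ : Fin N → S.Params, (∀ i t, 0 < (θ i).2 t) →
      (P θ).map (S.observe (y j)) =
        volume.withDensity (fun a => S.sampling (θ j) a.1 a.2)) ∧
    ∀ Y : S.Data, S.Regular Y →
      IsProbabilityMeasure (S.predictive Y) ∧
      S.predictive Y = volume.withDensity (fun y0 => ∏ t, S.condDensity t Y y0 (y0 t)) ∧
      ∀ (t : Fin s) (y0 : Fin s → ℝ),
        0 < S.dof t ∧ 0 < S.scale t Y y0 ∧
        S.condPredictive t Y y0 =
          PPCokriging.studentT (S.dof t) (S.location t Y y0) (S.scale t Y y0) := by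
  refine ⟨fun θ hθ => hmodel.map_observe hR hθ j, fun Y hY => ⟨?_, ?_, fun t y0 => ⟨?_, ?_, ?_⟩⟩⟩
  · exact PPCokriging.Setup.isProbabilityMeasure_predictive hR hY
  · exact PPCokriging.Setup.predictive_eq_withDensity_prod_condDensity hR hY
  · exact PPCokriging.Setup.dof_pos hR hY t
  · exact PPCokriging.Setup.scale_pos hR hY t y0
  · exact PPCokriging.Setup.condPredictive_eq_studentT hR hY t y0
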